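/- Let $\phi=\frac{1+\sqrt5}{2}$ and $$\sigma_0=\begin{pmatrix}1&\phi\\0&1\end{pmatrix},\quad \sigma_1=\begin{pmatrix}\phi&\phi\\1&\phi\end{pmatrix},\quad \sigma_2=\begin{pmatrix}\phi&1\\\phi&\phi\end{pmatrix},\quad \sigma_3=\begin{pmatrix}1&0\\\phi&1\end{pmatrix},\quad P=\begin{pmatrix}1&\cos(\pi/5)\\0&\sin(\pi/5)\end{pmatrix}.$$ For a finite, possibly empty word $w=k_1k_2\cdots k_n$ with letters in $\{0,1,2,3\}$ (a tree word) put $\mathbf v_w=\sigma_{k_n}\cdots\sigma_{k_2}\sigma_{k_1}\begin{pmatrix}1\\0\end{pmatrix}$, a vector of the golden L; the corresponding vector of the pentagon is $P\mathbf v_w$. Consider billiards in a regular pentagon with a horizontal bottom edge. A trajectory is a bi-infinite billiard path that never hits a corner, and its picture is the union of all its segments. The tree word $w$ is associated to the direction of a trajectory if some segment of the trajectory is traversed in the direction of $P\mathbf v_w$, up to rotation by a multiple of $\pi/5$. Consider the directed graph with nodes $A,B,C,D,E,F$ in which the arrows labelled $\sigma_k$ permute the nodes as follows: \begin{itemize}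 \item $\sigma_0$: $A\to B$, $B\to C$, $C\to D$, $D\to E$, $E\to A$, $F\to F$; \item $\sigma_1$: $A\to B$, $B\to D$, $C\to F$, $D\to A$, $E\to C$, $F\to E$; \item $\sigma_2$: $A\to B$, $B\to F$, $C\to E$, $D\to C$, $E\to D$, $F\to A$; \item $\sigma_3$: $A\to B$, $B\to E$, $C\to A$, $D\to D$, $E\to F$, $F\to C$. \end{itemize} Theorem. Let a trajectory of the pentagon billiard and a tree word $w=k_1\cdots k_n$ associated to its direction be given. Start at $A$, read $w$ backwards (the letters $k_n,\dots,k_1$ in this order), and for each letter $k$ follow the arrow labelled $\sigma_k$ backwards. If this walk ends at one of $A,B,C,D,E$, then the picture of the trajectory has rotational symmetry of order $5$: the rotations about the centre of the pentagon that preserve it are exactly those by the multiples of $2\pi/5$. If the walk ends at $F$, then the picture of the trajectory has no rotational symmetry: no nontrivial rotation of the plane preserves it. -/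

import Mathlib

namespace PentagonBilliard

noncomputable section

/-! ### The tree of periodic directions -/

/-- The matrices `σ₀, σ₁, σ₂, σ₃`. -/
def sigma : Fin 4 → Matrix (Fin 2) (Fin 2) ℝ :=
  ![!![1, Real.goldenRatio; 0, 1],
    !![Real.goldenRatio, Real.goldenRatio; 1, Real.goldenRatio],
    !![Real.goldenRatio, 1; Real.goldenRatio, Real.goldenRatio],
    !![1, 0; Real.goldenRatio, 1]]

/-- The vector `σ_{kₙ} ⋯ σ_{k₁} (1, 0)` of the golden L with tree word `k₁ ⋯ kₙ`
(the letters are listed in the order of application). -/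
def treeVector (w : List (Fin 4)) : Fin 2 → ℝ :=
  w.foldl (fun v k => (sigma k).mulVec v) ![1, 0]

/-- The matrix `P` that takes the golden L to the double pentagon. -/
def stretch : Matrix (Fin 2) (Fin 2) ℝ :=
  !![1, Real.cos (Real.pi / 5); 0, Real.sin (Real.pi / 5)]

/-- The vector of the plane `ℂ` of the double pentagon that belongs to a tree word. -/
def pentagonVector (w : List (Fin 4)) : ℂ :=
  ⟨stretch.mulVec (treeVector w) 0, stretch.mulVec (treeVector w) 1⟩

/-! ### The billiard in the regular pentagon -/

/-- The vertices, in counterclockwise order and with period 5, of the regular pentagon with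
centre `0` and a horizontal bottom edge (the one from `vertex 2` to `vertex 3`). -/
def vertex (k : ℕ) : ℂ :=
  Complex.I * Complex.exp (2 * Real.pi * Complex.I / 5) ^ k

/-- The unit vector that points from `x` to `y`. -/
def unitDirection (x y : ℂ) : ℂ := (y - x) / (‖y - x‖ : ℂ)

/-- A billiard trajectory in the pentagon that never hits a corner, given by the bi-infinite
sequence of its bounces: the `n`-th bounce is at the point `pt n` in the relative interior of the
edge from `vertex (edge n)` to `vertex (edge n + 1)`, and there the direction of motion is
reflected in the line spanned by that edge. -/
structure Trajectory where
  pt : ℤ → ℂ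
  edge : ℤ → Fin 5
  pt_mem : ∀ n, pt n ∈ openSegment ℝ (vertex (edge n : ℕ)) (vertex ((edge n : ℕ) + 1))
  edge_ne : ∀ n, edge (n + 1) ≠ edge n
  reflect : ∀ n, unitDirection (pt n) (pt (n + 1)) =
    (Submodule.span ℝ {vertex ((edge n : ℕ) + 1) - vertex (edge n : ℕ)}).reflection
      (unitDirection (pt (n - 1)) (pt n))

/-- The picture that a trajectory draws on the table: the union of all its segments. -/
def Trajectory.path (τ : Trajectory) : Set ℂ :=
  ⋃ n : ℤ, segment ℝ (τ.pt n) (τ.pt (n + 1))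

/-- The tree word `w` is associated to the direction of the trajectory: up to the 10-fold
rotational symmetry of the set of directions, the trajectory moves (in one of its segments) in
the direction of `pentagonVector w`. -/
def Trajectory.HasTreeWord (τ : Trajectory) (w : List (Fin 4)) : Prop :=
  ∃ (n : ℤ) (k : ℕ) (r : ℝ), 0 < r ∧
    τ.pt (n + 1) - τ.pt n =
      r * Complex.exp (Real.pi * Complex.I / 5) ^ k * pentagonVector w

/-! ### The graph on six nodes -/

/-- The nodes of the graph. -/
inductive Node
  | A | B | C | D | E | F
  deriving DecidableEq

open Node

/-- The arrows of the graph: the arrow labelled `σ_k` that starts at `X` ends at `arrow k X`.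
For each label the arrows permute the nodes, `arrow k` being given with its inverse. -/
def arrow : Fin 4 → Equiv.Perm Node :=
  ![{ toFun := fun | A => B | B => C | C => D | D => E | E => A | F => F
      invFun := fun | B => A | C => B | D => C | E => D | A => E | F => F
      left_inv := by rintro (_ | _) <;> rfl
      right_inv := by rintro (_ | _) <;> rfl },
    { toFun := fun | A => B | B => D | C => F | D => A | E => C | F => E
      invFun := fun | B => A | D => B | F => C | A => D | C => E | E => F
      left_inv := by rintro (_ | _) <;> rfl
      right_inv := by rintro (_ | _) <;> rfl },
    { toFun := fun | A => B | B => F | C => E | D => C | E => D | F => A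
      invFun := fun | B => A | F => B | E => C | C => D | D => E | A => F
      left_inv := by rintro (_ | _) <;> rfl
      right_inv := by rintro (_ | _) <;> rfl },
    { toFun := fun | A => B | B => E | C => A | D => D | E => F | F => C
      invFun := fun | B => A | E => B | A => C | D => D | F => E | C => F
      left_inv := by rintro (_ | _) <;> rfl
      right_inv := by rintro (_ | _) <;> rfl }]

/-- The node at which one ends: start at `A`, read the tree word backwards, and for each letter
`k` follow the arrow labelled `σ_k` backwards. -/
def endNode (w : List (Fin 4)) : Node :=
  w.reverse.foldl (fun X k => (arrow k).symm X) A

/-! ### Rotational symmetry of plane figures -/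

/-- The rotation of the plane about `c` by the unit complex number `a`. -/
def rotateAbout (c : ℂ) (a : Circle) (z : ℂ) : ℂ := c + (a : ℂ) * (z - c)

/-- The figure `S` is invariant under some nontrivial rotation of the plane. -/
def HasRotationalSymmetry (S : Set ℂ) : Prop :=
  ∃ (c : ℂ) (a : Circle), a ≠ 1 ∧ rotateAbout c a '' S = S

/-- The rotations about `c` that preserve the figure `S` are exactly those by the multiples
of `2π/m`. -/
def HasRotationalSymmetryOfOrder (m : ℕ) (c : ℂ) (S : Set ℂ) : Prop :=
  ∀ a : Circle, rotateAbout c a '' S = S ↔ a ^ m = 1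

end

end PentagonBilliard

open Complex ComplexConjugate

namespace PentagonBilliard

noncomputable section

/-! ### Constants -/

/-! The pentagon has circumradius 1 and inradius φ/2, so the edge with outward normal μ has midpoint
φμ/2. Gluing the pentagon to its half-turned copy along parallel edges gives the double pentagon, a
translation surface, and a billiard trajectory unfolds to a straight leaf on it (`Lift`). What the
unfolding forgets is the symmetry of the pentagon that carries the trajectory to the leaf. So when
the leaf closes up, the trajectory returns to its starting point and direction up to a rotation
`zeta ^ k`, and the picture has five-fold symmetry as soon as k ≢ 0 mod 5.

Leaves do close in tree directions. The surface consists of two horizontal cylinders of equal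
modulus (`modulus`), so a single shear is realised by a full Dehn twist in both, which takes leaves
to leaves (`Leaf.twisted`). In the basis 1, ω, the matrix σ_k is multiplication by ω^k followed by
this shear (`pentagonVector_append`). Starting from the horizontal direction, every leaf in the
direction v of a tree word therefore closes up with holonomy 2 sn φ · v or 2 sn φ · φv
(`closes_pentagonVector`).

The rotation can be read off from the holonomy: this is 2 sn φ · z with z in ℤ[ζ] and z ≡ 3k modulo
1 - ζ (`Lift.displacement`). The residue field is 𝔽₅, with φ ↦ 3 and ω ↦ -1. If (a, b) is the tree
vector modulo √5, then z is a nonzero multiple of a - b, so k ≢ 0 exactly when a ≠ b. The six nodes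
are the functionals on 𝔽₅² up to scalars; A is x - y, and F is the one that vanishes at (1, 0).
Walking backwards pulls A back along the word, so the walk ends at F exactly when a = b
(`endNode_eq_F_iff`).

Conversely, a rotation that preserves the picture permutes its segments, hence the sets of
directions in which segments leave the bounce points. At a bounce these add up to a negative
multiple of the normal, so normals go to normals, and the rotation is a rotation of the pentagon
(`rotation_of_image_eq`). If it preserves the sense of motion, its square is a return after an even
number of bounces, with holonomy parallel to v; for a = b such a holonomy has residue 0 and the
square is trivial. If it reverses the motion, its square fixes a bounce point and is trivial anyway.
A fifth root of unity with trivial square is 1. -/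

/-- The golden ratio. -/
def gold : ℝ := Real.goldenRatio

local notation "φ" => gold

theorem gold_sq : φ ^ 2 = φ + 1 := Real.goldenRatio_sq

theorem gold_pos : 0 < φ := Real.goldenRatio_pos

theorem gold_lower : (1.6 : ℝ) < φ := by
  have := gold_sq
  have := gold_pos
  nlinarith

theorem gold_upper : φ < (1.7 : ℝ) := by
  have := gold_sq
  have := gold_pos
  nlinarith

/-- The sine of `π / 5`. -/
def sn : ℝ := Real.sin (Real.pi / 5)

theorem cos_eq : Real.cos (Real.pi / 5) = φ / 2 := by
  rw [Real.cos_pi_div_five, gold, Real.goldenRatio]; ring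

theorem sn_sq : sn ^ 2 = (3 - φ) / 4 := by
  have := Real.sin_sq_add_cos_sq (Real.pi / 5)
  rw [cos_eq] at this
  unfold sn
  linarith [gold_sq]

theorem sn_pos : 0 < sn :=
  Real.sin_pos_of_pos_of_lt_pi (by positivity) (by linarith [Real.pi_pos])

theorem sn_ne : sn ≠ 0 := sn_pos.ne'

/-- The primitive tenth root of unity. -/
def omega : ℂ := ⟨φ / 2, sn⟩

theorem exp_eq_omega : exp (Real.pi * I / 5) = omega := by
  have : (Real.pi * I / 5 : ℂ) = ((Real.pi / 5 : ℝ) : ℂ) * I := by push_cast; ring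
  rw [this, exp_mul_I, ← ofReal_cos, ← ofReal_sin, cos_eq]
  apply Complex.ext <;> simp [omega, sn, -ofReal_sin, -ofReal_div]

theorem exp_eq_omega_sq : exp (2 * Real.pi * I / 5) = omega ^ 2 := by
  rw [← exp_eq_omega, ← exp_nat_mul]; congr 1; push_cast; ring

theorem omega_sq : omega ^ 2 = ⟨(φ - 1) / 2, φ * sn⟩ := by
  have := gold_sq; have := sn_sq
  apply Complex.ext <;> simp [omega, pow_two] <;> nlinarith

theorem omega_sq_eq : omega ^ 2 = φ * omega - 1 := by
  have := gold_sq
  rw [omega_sq]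
  apply Complex.ext <;> simp [omega]
  nlinarith

theorem gold_sq_complex : (φ : ℂ) ^ 2 = φ + 1 := by exact_mod_cast gold_sq

theorem omega_pow_five : omega ^ 5 = -1 := by
  have h := omega_sq_eq
  have g := gold_sq_complex
  linear_combination (omega ^ 3 + (φ : ℂ) * omega ^ 2 + (φ ^ 2 - 1) * omega + (φ ^ 3 - 2 * φ)) * h +
    ((φ ^ 2 + φ - 1) * omega - φ - 1) * g

/-- The scalar product of the plane. -/
def dot (z w : ℂ) : ℝ := z.re * w.re + z.im * w.im

theorem dot_eq (z w : ℂ) : dot z w = (z * conj w).re := by simp [dot]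

theorem dot_add_left (x y w : ℂ) : dot (x + y) w = dot x w + dot y w := by simp [dot]; ring

theorem dot_sub_left (x y w : ℂ) : dot (x - y) w = dot x w - dot y w := by simp [dot]; ring

theorem dot_real_mul_left (r : ℝ) (x w : ℂ) : dot (r * x) w = r * dot x w := by simp [dot]; ring

theorem dot_unit_mul {a : ℂ} (ha : a * conj a = 1) (z w : ℂ) : dot (a * z) (a * w) = dot z w := by
  rw [dot_eq, dot_eq, map_mul]
  congr 1
  linear_combination (z * conj w) * ha

theorem dot_conj (z w : ℂ) : dot (conj z) (conj w) = dot z w := by simp [dot]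

theorem mul_conj_of_pow_eq {a b : ℂ} {n : ℕ} (hn : n ≠ 0) (h : a ^ n = b) (hb : ‖b‖ = 1) :
    a * conj a = 1 := by
  have : ‖a‖ ^ n = 1 := by rw [← norm_pow, h, hb]
  rw [mul_conj, normSq_eq_norm_sq, (pow_eq_one_iff_of_nonneg (norm_nonneg a) hn).1 this]; simp

/-- Over ℤ[φ] the polynomial a⁵ - 1 factors as (a - 1)(a² - (φ - 1)a + 1)(a² + φa + 1). -/
theorem fifth_root_cases {a : ℂ} (ha : a ^ 5 = 1) :
    a = 1 ∨ a = ⟨(φ - 1) / 2, φ * sn⟩ ∨ a = ⟨(φ - 1) / 2, -(φ * sn)⟩ ∨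
      a = ⟨-(φ / 2), sn⟩ ∨ a = ⟨-(φ / 2), -sn⟩ := by
  have g := gold_sq_complex
  have hs : (sn : ℂ) ^ 2 = (3 - φ) / 4 := by exact_mod_cast sn_sq
  have e : ∀ x y : ℝ, (⟨x, y⟩ : ℂ) = x + y * I := fun x y => by apply Complex.ext <;> simp
  have key : (a - 1) * ((a - ⟨(φ - 1) / 2, φ * sn⟩) * (a - ⟨(φ - 1) / 2, -(φ * sn)⟩) *
      ((a - ⟨-(φ / 2), sn⟩) * (a - ⟨-(φ / 2), -sn⟩))) = 0 := by
    have h1 : (a - ⟨(φ - 1) / 2, φ * sn⟩) * (a - ⟨(φ - 1) / 2, -(φ * sn)⟩) =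
        a ^ 2 - (φ - 1) * a + 1 := by
      rw [e, e]; push_cast
      linear_combination (-(φ : ℂ) ^ 2 * sn ^ 2) * I_sq + φ ^ 2 * hs + (3 / 4 - φ / 4 ) * g
    have h2 : (a - ⟨-(φ / 2), sn⟩) * (a - ⟨-(φ / 2), -sn⟩) = a ^ 2 + φ * a + 1 := by
      rw [e, e]; push_cast
      linear_combination (-(sn : ℂ) ^ 2) * I_sq + hs + (1 / 4) * g
    rw [h1, h2]
    linear_combination ha - (a - 1) * a ^ 2 * g
  simp only [mul_eq_zero, sub_eq_zero] at key
  tauto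

/-! ### The pentagon and its normals -/

/-- The outward unit normals of the edges of the pentagon. -/
def IsNormal (μ : ℂ) : Prop := μ ^ 5 = -I

theorem IsNormal.mul_conj {μ : ℂ} (h : IsNormal μ) : μ * conj μ = 1 :=
  mul_conj_of_pow_eq (by norm_num) h (by simp)

theorem IsNormal.root_mul {μ a : ℂ} (h : IsNormal μ) (ha : a ^ 5 = 1) : IsNormal (a * μ) := by
  unfold IsNormal at *
  rw [mul_pow, ha, h, one_mul]

theorem IsNormal.mirror {μ ν : ℂ} (hμ : IsNormal μ) (hν : IsNormal ν) :
    IsNormal (μ ^ 2 * conj ν) := by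
  unfold IsNormal at *
  rw [mul_pow, ← map_pow, hν, ← pow_mul, mul_comm 2 5, pow_mul, hμ]
  simp

theorem IsNormal.dot_self {μ : ℂ} (h : IsNormal μ) : dot μ μ = 1 := by
  rw [dot_eq, h.mul_conj]; simp

theorem isNormal_neg_I : IsNormal (-I) := by
  unfold IsNormal
  linear_combination (-I ^ 3 + I) * I_sq

theorem IsNormal.cases {μ : ℂ} (h : IsNormal μ) :
    μ = -I ∨ μ = ⟨φ * sn, -((φ - 1) / 2)⟩ ∨ μ = ⟨-(φ * sn), -((φ - 1) / 2)⟩ ∨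
      μ = ⟨sn, φ / 2⟩ ∨ μ = ⟨-sn, φ / 2⟩ := by
  have h1 : (I * μ) ^ 5 = 1 := by
    unfold IsNormal at h
    rw [mul_pow, h]
    linear_combination (- I ^ 4 + I ^ 2 - 1) * I_sq
  have h2 : μ = -I * (I * μ) := by linear_combination μ * I_sq
  rcases fifth_root_cases h1 with h | h | h | h | h <;> rw [h] at h2 <;> rw [h2]
  · simp
  · right; left; apply Complex.ext <;> simp
  · right; right; left; apply Complex.ext <;> simp
  · right; right; right; left; apply Complex.ext <;> simp
  · right; right; right; right; apply Complex.ext <;> simp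

theorem fifth_root_omega : (⟨(φ - 1) / 2, φ * sn⟩ : ℂ) ^ 5 = 1 := by
  rw [← omega_sq, ← pow_mul, mul_comm, pow_mul, omega_pow_five]; norm_num

theorem fifth_root_omega_sq : (⟨-(φ / 2), sn⟩ : ℂ) ^ 5 = 1 := by
  have : (⟨-(φ / 2), sn⟩ : ℂ) = -conj omega := by apply Complex.ext <;> simp [omega]
  rw [this, Odd.neg_pow (by decide), ← map_pow, omega_pow_five]; simp

theorem isNormal_of_root {a μ : ℂ} (ha : a ^ 5 = 1) (h : μ = -I * a) : IsNormal μ := by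
  rw [h, mul_comm]; exact isNormal_neg_I.root_mul ha

theorem isNormal_lower : IsNormal ⟨φ * sn, -((φ - 1) / 2)⟩ :=
  isNormal_of_root fifth_root_omega (by apply Complex.ext <;> simp)

theorem isNormal_upper : IsNormal ⟨sn, φ / 2⟩ :=
  isNormal_of_root fifth_root_omega_sq (by apply Complex.ext <;> simp)

theorem IsNormal.flip {x y : ℝ} (h : IsNormal ⟨x, y⟩) : IsNormal ⟨-x, y⟩ := by
  have := isNormal_neg_I.mirror h
  convert this using 1
  apply Complex.ext <;> simp [pow_two]

/-- The closed pentagon. -/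
def pentagon : Set ℂ := {z | ∀ μ, IsNormal μ → dot z μ ≤ φ / 2}

/-- The pentagon is symmetric in the imaginary axis, so the inequalities of its four slanted edges
merge in pairs. -/
theorem mem_pentagon_iff {z : ℂ} : z ∈ pentagon ↔
    -(φ / 2) ≤ z.im ∧ |z.re| * (φ * sn) - z.im * ((φ - 1) / 2) ≤ φ / 2 ∧
      |z.re| * sn + z.im * (φ / 2) ≤ φ / 2 := by
  have hφ := gold_pos
  have hs := sn_pos
  constructor
  · intro h
    have h0 := h _ isNormal_neg_I
    have h1 := h _ isNormal_lower
    have h2 := h _ isNormal_lower.flip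
    have h3 := h _ isNormal_upper
    have h4 := h _ isNormal_upper.flip
    simp only [dot, neg_re, neg_im, I_re, I_im] at h0 h1 h2 h3 h4
    refine ⟨by linarith, ?_, ?_⟩ <;> rcases abs_cases z.re with ⟨e, _⟩ | ⟨e, _⟩ <;> rw [e] <;> linarith
  · rintro ⟨h0, h1, h2⟩ μ hμ
    have e1 := mul_le_mul_of_nonneg_right (le_abs_self z.re) hs.le
    have e2 := mul_le_mul_of_nonneg_right (neg_abs_le z.re) hs.le
    have e3 := mul_le_mul_of_nonneg_right (le_abs_self z.re) (mul_pos hφ hs).le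
    have e4 := mul_le_mul_of_nonneg_right (neg_abs_le z.re) (mul_pos hφ hs).le
    rcases hμ.cases with h | h | h | h | h <;> rw [h] <;>
      simp only [dot, neg_re, neg_im, I_re, I_im] <;> linarith

theorem pentagon_convex {x y : ℂ} (hx : x ∈ pentagon) (hy : y ∈ pentagon) {s : ℝ} (h0 : 0 ≤ s)
    (h1 : s ≤ 1) : x + s * (y - x) ∈ pentagon := by
  intro μ hμ
  have := hx μ hμ
  have := hy μ hμ
  rw [dot_add_left, dot_real_mul_left, dot_sub_left]
  nlinarith

theorem root_mul_mem_pentagon {a z : ℂ} (ha : a ^ 5 = 1) (hz : z ∈ pentagon) :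
    a * z ∈ pentagon := by
  intro μ hμ
  have hc : a * conj a = 1 := mul_conj_of_pow_eq (by norm_num) ha (by simp)
  have h1 : IsNormal (conj a * μ) := hμ.root_mul (by rw [← map_pow, ha, map_one])
  have h2 := hz _ h1
  rwa [← dot_unit_mul hc, ← mul_assoc, hc, one_mul] at h2

/-- The reflection of the pentagon in its axis of direction `μ`. -/
def mirror (μ z : ℂ) : ℂ := μ ^ 2 * conj z

theorem mirror_mirror {μ : ℂ} (h : IsNormal μ) (z : ℂ) : mirror μ (mirror μ z) = z := by
  have := h.mul_conj
  simp only [mirror, map_mul, map_pow, conj_conj]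
  linear_combination (z * (μ * conj μ + 1)) * this

theorem dot_mirror {μ : ℂ} (h : IsNormal μ) (z w : ℂ) :
    dot (mirror μ z) (mirror μ w) = dot z w := by
  unfold mirror
  rw [dot_unit_mul, dot_conj]
  have := h.mul_conj
  rw [map_pow]
  linear_combination (μ * conj μ + 1) * this

theorem mirror_eq {μ : ℂ} (h : IsNormal μ) (z : ℂ) : mirror μ z = (2 * dot z μ : ℝ) * μ - z := by
  have h1 := h.mul_conj
  have : ((2 * dot z μ : ℝ) : ℂ) = z * conj μ + conj z * μ := by
    apply Complex.ext <;> simp [dot] <;> ring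
  rw [this]
  unfold mirror
  linear_combination (-z) * h1

theorem mirror_mem_pentagon {μ z : ℂ} (h : IsNormal μ) (hz : z ∈ pentagon) :
    mirror μ z ∈ pentagon := by
  intro ν hν
  rw [← mirror_mirror h ν, dot_mirror h]
  exact hz _ (h.mirror hν)

/-- A point of an edge is taken by the reflection in its midpoint to a point of that edge. -/
theorem edge_flip {μ z : ℂ} (h : IsNormal μ) (he : dot z μ = φ / 2) :
    φ * μ - z = mirror μ z := by
  rw [mirror_eq h, he]; push_cast; ring

/-! ### Leaves of the linear flows on the double pentagon

A point of the double pentagon is a pair `(ε, y)` with `ε = ±1` and `y` in the pentagon; it stands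
for the point `ε * y` of the copy `ε * pentagon` of the pentagon. -/

/-- The pair `p` is a point of the double pentagon. -/
def Valid (p : ℝ × ℂ) : Prop := (p.1 = 1 ∨ p.1 = -1) ∧ p.2 ∈ pentagon

/-- `Leaf u p q t`: the flow in direction `u` may take `p` to `q` in time `t` (which may be
negative). At the corners all continuations are allowed. -/
inductive Leaf (u : ℂ) : ℝ × ℂ → ℝ × ℂ → ℝ → Prop
  | move {ε : ℝ} {y : ℂ} {t : ℝ} : Valid (ε, y) → y + ε * t * u ∈ pentagon →
      Leaf u (ε, y) (ε, y + ε * t * u) t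
  | glue {ε : ℝ} {y μ : ℂ} : Valid (ε, y) → IsNormal μ → dot y μ = φ / 2 →
      Leaf u (ε, y) (-ε, φ * μ - y) 0
  | symm {p q : ℝ × ℂ} {t : ℝ} : Leaf u p q t → Leaf u q p (-t)
  | trans {p q r : ℝ × ℂ} {s t : ℝ} : Leaf u p q s → Leaf u q r t → Leaf u p r (s + t)

theorem Valid.move {ε : ℝ} {y z : ℂ} (h : Valid (ε, y)) (hz : z ∈ pentagon) : Valid (ε, z) :=
  ⟨h.1, hz⟩

theorem Valid.glue {ε : ℝ} {y μ : ℂ} (h : Valid (ε, y)) (hμ : IsNormal μ)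
    (he : dot y μ = φ / 2) : Valid (-ε, φ * μ - y) := by
  refine ⟨?_, ?_⟩
  · rcases h.1 with h | h <;> simp only at h ⊢ <;> simp [h]
  · rw [edge_flip hμ he]
    exact mirror_mem_pentagon hμ h.2

theorem Leaf.valid {u : ℂ} {p q : ℝ × ℂ} {t : ℝ} (h : Leaf u p q t) : Valid p ∧ Valid q := by
  induction h with
  | move h h' => exact ⟨h, h.move h'⟩
  | glue h hμ he => exact ⟨h, h.glue hμ he⟩
  | symm _ ih => exact ih.symm
  | trans _ _ ih ih' => exact ⟨ih.1, ih'.2⟩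

theorem Leaf.symm_zero {u : ℂ} {p q : ℝ × ℂ} (h : Leaf u p q 0) : Leaf u q p 0 := by
  simpa using h.symm

theorem Leaf.trans_zero {u : ℂ} {p q r : ℝ × ℂ} {t : ℝ} (h : Leaf u p q t) (h' : Leaf u q r 0) :
    Leaf u p r t := by
  simpa using h.trans h'

theorem Leaf.zero_trans {u : ℂ} {p q r : ℝ × ℂ} {t : ℝ} (h : Leaf u p q 0) (h' : Leaf u q r t) :
    Leaf u p r t := by
  simpa using h.trans h'

/-! ### The two horizontal cylinders -/

/-- The height in the pentagon of the middle of the lower (`true`) and of the upper part. -/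
def ctr (i : Bool) : ℝ := bif i then -(1 / 4) else (φ + 1) / 4

/-- The height of a cylinder. -/
def hgt (i : Bool) : ℝ := bif i then (2 * φ - 1) / 2 else (3 - φ) / 2

/-- The circumference of a cylinder. -/
def circ (i : Bool) : ℝ := bif i then 2 * sn * (φ + 1) else 2 * sn * φ

/-- The slope of the sides of a cylinder. -/
def slp (i : Bool) : ℝ := bif i then (2 - φ) / (2 * sn) else -φ / (2 * sn)

theorem circ_pos (i : Bool) : 0 < circ i := by
  have := gold_pos; have := sn_pos
  cases i <;> simp only [circ, cond] <;> positivity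

theorem hgt_pos (i : Bool) : 0 < hgt i := by
  have := gold_lower; have := gold_upper
  cases i <;> simp only [hgt, cond] <;> linarith

theorem slp_mul_sn (i : Bool) : slp i * sn = bif i then (2 - φ) / 2 else -φ / 2 := by
  have := sn_ne
  cases i <;> simp only [slp, cond] <;> field_simp

/-- This says that the two slanted sides of a tile do not cross. For the upper part it is an
equality, since that part is a triangle and the sides meet at its apex. -/
theorem slp_bound (i : Bool) : |slp i| * (hgt i / 2) ≤ circ i / 4 := by
  have g := gold_sq; have s := sn_sq; have s0 := sn_pos; have l := gold_lower
  have l' := gold_upper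
  -- After multiplication by `sn` only `sn ^ 2` occurs, and this is rational in φ.
  rw [← mul_le_mul_iff_left₀ s0]
  have : |slp i| * (hgt i / 2) * sn = |slp i * sn| * (hgt i / 2) := by
    rw [abs_mul, abs_of_pos s0]; ring
  rw [this, slp_mul_sn]
  cases i <;> simp only [hgt, circ, cond]
  · rw [abs_of_neg (by linarith)]
    nlinarith
  · rw [abs_of_pos (by linarith)]
    nlinarith

/-- Below the horizontal diagonal the lower slanted edges bound the pentagon, above it the upper
ones; within the level the other inequalities follow. -/
theorem mem_pentagon_level {i : Bool} {y : ℂ} (h : |y.im - ctr i| ≤ hgt i / 2) :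
    y ∈ pentagon ↔ |y.re| ≤ circ i / 4 + slp i * (y.im - ctr i) := by
  have g := gold_sq; have s := sn_sq; have s0 := sn_pos; have l := gold_lower
  have l' := gold_upper
  have e := slp_mul_sn i
  rw [mem_pentagon_iff, ← mul_le_mul_iff_left₀ s0 (b := |y.re|), add_mul, mul_right_comm, e]
  obtain ⟨h1, h2⟩ := abs_le.1 h
  cases i <;> simp only [hgt, circ, ctr, cond] at *
  · have : 2 * sn * φ / 4 * sn + -φ / 2 * (y.im - (φ + 1) / 4) = φ / 2 * (1 - y.im) := by
      linear_combination (φ / 2) * s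
    rw [this]
    constructor
    · rintro ⟨-, -, h⟩; linarith
    · intro h
      refine ⟨by linarith, ?_, by linarith⟩
      nlinarith
  · have : φ * (2 * sn * (φ + 1) / 4 * sn + (2 - φ) / 2 * (y.im - -(1 / 4))) =
        φ / 2 + y.im * ((φ - 1) / 2) := by
      linear_combination (φ * (φ + 1) / 2) * s + (-φ / 8 - y.im / 2) * g
    constructor
    · rintro ⟨-, h, -⟩
      refine le_of_mul_le_mul_left ?_ (gold_pos)
      rw [this]; linarith
    · intro h
      have h3 := mul_le_mul_of_nonneg_left h gold_pos.le
      rw [this] at h3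
      refine ⟨by linarith, by linarith, ?_⟩
      have h4 : φ * (|y.re| * sn) ≤ φ * (φ / 2 - y.im * (φ / 2)) := by nlinarith
      linarith [le_of_mul_le_mul_left h4 gold_pos]

/-! ### Tiling of the strip over a cylinder by pieces of the two pentagons -/

/-- The sign of the copy of the pentagon that contains the tile with number `k`. -/
def sg (k : ℤ) : ℝ := (-1) ^ k

theorem sg_cases (k : ℤ) : sg k = 1 ∨ sg k = -1 := by
  rcases Int.even_or_odd k with h | h
  · left; exact h.neg_one_zpow
  · right; exact h.neg_one_zpow

theorem sg_mul_self (k : ℤ) : sg k * sg k = 1 := by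
  rcases sg_cases k with h | h <;> rw [h] <;> norm_num

theorem sg_succ (k : ℤ) : sg (k + 1) = -sg k := by
  unfold sg; rw [zpow_add_one₀ (by norm_num)]; ring

theorem sg_add_two_mul (k m : ℤ) : sg (k + 2 * m) = sg k := by
  unfold sg; rw [zpow_add₀ (by norm_num), zpow_mul]; norm_num

theorem sg_eq_iff {k l : ℤ} (h : sg k = sg l) : ∃ m, l = k + 2 * m := by
  rcases Int.even_or_odd (l - k) with ⟨m, hm⟩ | ⟨m, hm⟩
  · exact ⟨m, by omega⟩
  · have : l = k + 2 * m + 1 := by omega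
    rw [this, sg_succ, sg_add_two_mul] at h
    rcases sg_cases k with h' | h' <;> rw [h'] at h <;> norm_num at h

/-- The point of the strip over the cylinder `i` lies in the tile with number `k`. -/
def InTile (i : Bool) (k : ℤ) (b : ℂ) : Prop :=
  |b.im| ≤ hgt i / 2 ∧ |b.re - k * (circ i / 2)| ≤ circ i / 4 + sg k * slp i * b.im

/-- The point of the double pentagon below a point of the tile with number `k`. -/
def tilePoint (i : Bool) (k : ℤ) (b : ℂ) : ℝ × ℂ :=
  (sg k, sg k * (b - (k * (circ i / 2) : ℝ)) + ctr i * I)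

theorem tilePoint_im (i : Bool) (k : ℤ) (b : ℂ) :
    (tilePoint i k b).2.im - ctr i = sg k * b.im := by
  simp [tilePoint]

theorem tilePoint_re (i : Bool) (k : ℤ) (b : ℂ) :
    (tilePoint i k b).2.re = sg k * (b.re - k * (circ i / 2)) := by
  simp [tilePoint]

theorem abs_sg_mul (k : ℤ) (x : ℝ) : |sg k * x| = |x| := by
  rcases sg_cases k with h | h <;> rw [h] <;> simp

theorem inTile_iff {i : Bool} {k : ℤ} {b : ℂ} : InTile i k b ↔
    |(tilePoint i k b).2.im - ctr i| ≤ hgt i / 2 ∧ (tilePoint i k b).2 ∈ pentagon := by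
  unfold InTile
  rw [tilePoint_im, abs_sg_mul]
  refine and_congr_right fun h => ?_
  rw [mem_pentagon_level (i := i) (by rwa [tilePoint_im, abs_sg_mul]), tilePoint_im, tilePoint_re,
    abs_sg_mul, mul_left_comm, ← mul_assoc]

theorem InTile.valid {i : Bool} {k : ℤ} {b : ℂ} (h : InTile i k b) : Valid (tilePoint i k b) :=
  ⟨sg_cases k, (inTile_iff.1 h).2⟩

theorem InTile.leaf_same {i : Bool} {k : ℤ} {b u : ℂ} {t : ℝ} (h : InTile i k b)
    (h' : InTile i k (b + t * u)) : Leaf u (tilePoint i k b) (tilePoint i k (b + t * u)) t := by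
  have e : tilePoint i k (b + t * u) =
      ((tilePoint i k b).1, (tilePoint i k b).2 + ((tilePoint i k b).1 : ℝ) * t * u) := by
    ext1
    · rfl
    · simp only [tilePoint]; ring
  rw [e]
  refine Leaf.move h.valid ?_
  have := h'.valid.2
  rwa [e] at this

/-- Neighbouring tiles share a slanted side, and the half-turn about its midpoint is exactly the
gluing of the double pentagon along that edge. -/
theorem InTile.leaf_succ {i : Bool} {k : ℤ} {b u : ℂ} (h : InTile i k b)
    (h' : InTile i (k + 1) b) : Leaf u (tilePoint i k b) (tilePoint i (k + 1) b) 0 := by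
  have g := gold_sq; have s := sn_sq; have s0 := sn_pos; have l := gold_lower
  have l' := gold_upper
  have e := slp_mul_sn i
  -- The right bound of tile k and the left bound of tile k + 1 are the same line, so both
  -- inequalities are equalities.
  have hre : b.re - k * (circ i / 2) = circ i / 4 + sg k * slp i * b.im := by
    have h1 := (abs_le.1 h.2).2
    have h2 := (abs_le.1 h'.2).1
    rw [sg_succ] at h2
    push_cast at h2
    linarith
  obtain ⟨μ, hμ, e1, e2⟩ : ∃ μ, IsNormal μ ∧
      tilePoint i (k + 1) b = (-(tilePoint i k b).1, φ * μ - (tilePoint i k b).2) ∧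
      dot (tilePoint i k b).2 μ = φ / 2 := by
    -- The vector φμ is twice the midpoint of the edge, which lies at height `ctr i`. The sign of
    -- its real part alternates because odd tiles are upside down.
    have main : ∀ μ : ℂ, φ * μ.re = sg k * (circ i / 2) → φ * μ.im = 2 * ctr i →
        tilePoint i (k + 1) b = (-(tilePoint i k b).1, φ * μ - (tilePoint i k b).2) := by
      intro μ h1 h2
      ext1
      · simp [tilePoint, sg_succ]
      · apply Complex.ext
        · simp [tilePoint, sg_succ, h1]; ring
        · simp [tilePoint, sg_succ, h2]; ring
    have eim : (tilePoint i k b).2.im = sg k * b.im + ctr i := by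
      linarith [tilePoint_im i k b]
    cases i
    · refine ⟨⟨sg k * sn, φ / 2⟩, ?_, ?_, ?_⟩
      · rcases sg_cases k with h | h <;> rw [h]
        · simpa using isNormal_upper
        · simpa using isNormal_upper.flip
      · apply main <;> simp only [circ, ctr, cond]
        · ring
        · nlinarith
      · rw [dot, eim, tilePoint_re, hre]
        simp only [circ, ctr, cond] at e ⊢
        have := sg_mul_self k
        linear_combination (φ / 2 * sn ^ 2 + sg k * b.im * slp false * sn) * this +
          sg k * b.im * e + φ / 2 * s
    · refine ⟨⟨sg k * (φ * sn), -((φ - 1) / 2)⟩, ?_, ?_, ?_⟩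
      · rcases sg_cases k with h | h <;> rw [h]
        · simpa using isNormal_lower
        · simpa using isNormal_lower.flip
      · apply main <;> simp only [circ, ctr, cond]
        · linear_combination sg k * sn * g
        · nlinarith
      · rw [dot, eim, tilePoint_re, hre]
        simp only [circ, ctr, cond] at e ⊢
        have := sg_mul_self k
        linear_combination
          (φ * (φ + 1) / 2 * sn ^ 2 + φ * sn * (sg k * b.im * slp true)) * this +
          φ * sg k * b.im * e + (φ * (φ + 1) / 2) * s + (1 / 8 - φ / 8 - sg k * b.im / 2) * g
  rw [e1]
  exact Leaf.glue h.valid hμ e2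

theorem abs_convex {x y z r s : ℝ} (h0 : 0 ≤ s) (h1 : s ≤ 1) (hx : |x| ≤ r) (hy : |y| ≤ r)
    (hz : z = x + s * (y - x)) : |z| ≤ r := by
  rw [abs_le] at *
  constructor <;> nlinarith

theorem slp_mul_im_bound {i : Bool} {b : ℂ} (h : |b.im| ≤ hgt i / 2) (k : ℤ) :
    |sg k * slp i * b.im| ≤ circ i / 4 := by
  rw [mul_assoc, abs_sg_mul, abs_mul]
  exact (mul_le_mul_of_nonneg_left h (abs_nonneg _)).trans (slp_bound i)

/-- A straight line in the strip that leaves a tile to the right passes through the next tile. -/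
theorem InTile.crossing {i : Bool} {k l : ℤ} {b u : ℂ} {t : ℝ} (h : InTile i k b)
    (h' : InTile i l (b + t * u)) (hkl : k < l) :
    ∃ s : ℝ, InTile i k (b + s * u) ∧ InTile i (k + 1) (b + s * u) := by
  -- The affine function `g` is the signed horizontal distance from the right side of tile k; the
  -- crossing point is its zero on the line.
  set g : ℂ → ℝ := fun z => z.re - k * (circ i / 2) - circ i / 4 - sg k * slp i * z.im with hg
  have g0 : g b ≤ 0 := by
    have := (abs_le.1 h.2).2
    simp only [hg]; linarith
  have c0 := circ_pos i
  have g1 : 0 ≤ g (b + t * u) := by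
    have h1 := (abs_le.1 h'.2).1
    simp only [hg]
    rcases eq_or_lt_of_le (show k + 1 ≤ l from hkl) with e | e
    · rw [← e, sg_succ] at h1
      push_cast at h1
      linarith
    · have h2 := (abs_le.1 (slp_mul_im_bound h'.1 k)).2
      have h3 := (abs_le.1 (slp_mul_im_bound h'.1 l)).2
      have h4 : (k : ℝ) + 2 ≤ l := by exact_mod_cast (show k + 2 ≤ l by omega)
      nlinarith
  obtain ⟨θ, t0, t1, hθ⟩ : ∃ θ : ℝ, 0 ≤ θ ∧ θ ≤ 1 ∧ g b + θ * (g (b + t * u) - g b) = 0 := by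
    rcases eq_or_lt_of_le g0 with e | e
    · exact ⟨0, le_rfl, zero_le_one, by rw [e]; ring⟩
    · have hd : 0 < g (b + t * u) - g b := by linarith
      refine ⟨-g b / (g (b + t * u) - g b), by apply div_nonneg <;> linarith, ?_, ?_⟩
      · rw [div_le_one hd]; linarith
      · rw [div_mul_cancel₀ _ hd.ne']; ring
  have him : |(b + (θ * t : ℝ) * u).im| ≤ hgt i / 2 :=
    abs_convex t0 t1 h.1 h'.1 (by simp; ring)
  have hz : g (b + (θ * t : ℝ) * u) = 0 := by
    rw [← hθ]; simp [hg]; ring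
  have hk := abs_le.1 (slp_mul_im_bound him k)
  simp only [hg] at hz
  refine ⟨θ * t, ⟨him, ?_⟩, ⟨him, ?_⟩⟩
  · rw [abs_le]; constructor <;> linarith
  · rw [sg_succ, abs_le, Int.cast_add, Int.cast_one]; constructor <;> linarith

theorem InTile.leaf_add {i : Bool} {u : ℂ} (n : ℕ) : ∀ {k : ℤ} {b : ℂ} {t : ℝ}, InTile i k b →
    InTile i (k + n) (b + t * u) → Leaf u (tilePoint i k b) (tilePoint i (k + n) (b + t * u)) t := by
  induction n with
  | zero =>
    intro k b t h h'
    simp only [Nat.cast_zero, add_zero] at h' ⊢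
    exact h.leaf_same h'
  | succ n ih =>
    intro k b t h h'
    obtain ⟨s, h1, h2⟩ := h.crossing h' (by omega)
    have e : b + t * u = b + s * u + (t - s : ℝ) * u := by push_cast; ring
    have e' : k + (n + 1 : ℕ) = k + 1 + n := by push_cast; ring
    rw [e, e'] at h' ⊢
    have := ((h.leaf_same h1).trans_zero (h1.leaf_succ h2)).trans (ih h2 h')
    rwa [add_sub_cancel] at this

/-- A straight line in the strip over a cylinder gives a piece of a leaf. -/
theorem InTile.leaf {i : Bool} {k l : ℤ} {b u : ℂ} {t : ℝ} (h : InTile i k b)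
    (h' : InTile i l (b + t * u)) : Leaf u (tilePoint i k b) (tilePoint i l (b + t * u)) t := by
  rcases le_total k l with e | e
  · obtain ⟨n, rfl⟩ := Int.le.dest e
    exact h.leaf_add n h'
  · obtain ⟨n, rfl⟩ := Int.le.dest e
    have e1 : b = b + t * u + (-t : ℝ) * u := by push_cast; ring
    rw [e1] at h
    have := (h'.leaf_add n h).symm
    rwa [neg_neg, ← e1] at this

/-! ### Strips as charts of the double pentagon -/

/-- The point `p` of the double pentagon lies below the point `b` of the strip over the
cylinder `i`. -/
def Chart (i : Bool) (p : ℝ × ℂ) (b : ℂ) : Prop := ∃ k : ℤ, p = tilePoint i k b ∧ InTile i k b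

theorem Chart.leaf {i : Bool} {p q : ℝ × ℂ} {b b' u : ℂ} {t : ℝ} (h : Chart i p b)
    (h' : Chart i q b') (e : b' = b + t * u) : Leaf u p q t := by
  obtain ⟨k, rfl, h⟩ := h
  obtain ⟨l, rfl, h'⟩ := h'
  subst e
  exact h.leaf h'

theorem Chart.leaf_zero {i : Bool} {p q : ℝ × ℂ} {b u : ℂ} (h : Chart i p b)
    (h' : Chart i q b) : Leaf u p q 0 :=
  h.leaf h' (by simp)

theorem Chart.valid {i : Bool} {p : ℝ × ℂ} {b : ℂ} (h : Chart i p b) : Valid p := by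
  obtain ⟨k, rfl, h⟩ := h
  exact h.valid

theorem Chart.im_le {i : Bool} {p : ℝ × ℂ} {b : ℂ} (h : Chart i p b) : |b.im| ≤ hgt i / 2 := by
  obtain ⟨k, rfl, h⟩ := h
  exact h.1

theorem exists_chart_of_im {i : Bool} {b : ℂ} (h : |b.im| ≤ hgt i / 2) : ∃ p, Chart i p b := by
  suffices ∃ k, InTile i k b from this.imp' (fun k => tilePoint i k b) fun k hk => ⟨k, rfl, hk⟩
  have c0 := circ_pos i
  -- Tile centres are `circ i / 2` apart, so b lies between the centres of tiles m and m + 1, and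
  -- their common side decides between them.
  set m := ⌊b.re / (circ i / 2)⌋ with hm
  have h1 : m * (circ i / 2) ≤ b.re := by
    rw [← le_div_iff₀ (by positivity)]; exact Int.floor_le _
  have h2 : b.re ≤ (m + 1) * (circ i / 2) := by
    rw [← div_le_iff₀ (by positivity)]; exact (Int.lt_floor_add_one _).le
  have h3 := abs_le.1 (slp_mul_im_bound h m)
  rcases le_total (b.re - m * (circ i / 2)) (circ i / 4 + sg m * slp i * b.im) with h4 | h4
  · refine ⟨m, h, ?_⟩
    rw [abs_le]; constructor <;> linarith
  · refine ⟨m + 1, h, ?_⟩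
    rw [abs_le, sg_succ]; push_cast; constructor <;> linarith

theorem Chart.deck {i : Bool} {p : ℝ × ℂ} {b : ℂ} (h : Chart i p b) (m : ℤ) :
    Chart i p (b + (m * circ i : ℝ)) := by
  obtain ⟨k, rfl, h⟩ := h
  refine ⟨k + 2 * m, ?_, by simpa using h.1, ?_⟩
  · unfold tilePoint
    rw [sg_add_two_mul]
    congr 2
    push_cast; ring
  · rw [sg_add_two_mul]
    convert h.2 using 2
    · simp; ring
    · simp

theorem Chart.unique {i : Bool} {p : ℝ × ℂ} {b b' : ℂ} (h : Chart i p b) (h' : Chart i p b') :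
    ∃ m : ℤ, b' = b + (m * circ i : ℝ) := by
  obtain ⟨k, rfl, h⟩ := h
  obtain ⟨l, e, h'⟩ := h'
  simp only [tilePoint, Prod.mk.injEq] at e
  obtain ⟨m, rfl⟩ := sg_eq_iff e.1
  refine ⟨m, ?_⟩
  rw [sg_add_two_mul] at e
  have h0 : (sg k : ℂ) ≠ 0 := by
    rcases sg_cases k with h | h <;> rw [h] <;> norm_num
  have := mul_left_cancel₀ h0 (add_right_cancel e.2)
  push_cast at this ⊢
  linear_combination -this

theorem exists_chart_of_level {i : Bool} {p : ℝ × ℂ} (hp : Valid p)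
    (h : |p.2.im - ctr i| ≤ hgt i / 2) : ∃ b, Chart i p b := by
  obtain ⟨ε, y⟩ := p
  obtain ⟨k, hk⟩ : ∃ k, sg k = ε := by
    rcases hp.1 with e | e
    · exact ⟨0, by simpa [sg] using e.symm⟩
    · exact ⟨1, by simpa [sg] using e.symm⟩
  subst hk
  have e : (sg k, y) = tilePoint i k (sg k * (y - ctr i * I) + (k * (circ i / 2) : ℝ)) := by
    have : (sg k : ℂ) * sg k = 1 := by exact_mod_cast sg_mul_self k
    ext1
    · rfl
    · simp only [tilePoint]
      linear_combination (ctr i * I - y) * this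
  exact ⟨_, k, e, inTile_iff.2 (e ▸ ⟨h, hp.2⟩)⟩

theorem level_cases {y : ℂ} (h : y ∈ pentagon) : ∃ i, |y.im - ctr i| ≤ hgt i / 2 := by
  have l := gold_lower; have l' := gold_upper; have s := sn_pos
  obtain ⟨h1, h2, h3⟩ := mem_pentagon_iff.1 h
  have h4 : y.im ≤ 1 := by
    have : 0 ≤ |y.re| * sn := by positivity
    nlinarith
  rcases le_total y.im ((φ - 1) / 2) with e | e
  · refine ⟨true, ?_⟩
    rw [abs_le]; simp only [ctr, hgt, cond]; constructor <;> linarith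
  · refine ⟨false, ?_⟩
    rw [abs_le]; simp only [ctr, hgt, cond]; constructor <;> linarith

theorem exists_chart {p : ℝ × ℂ} (hp : Valid p) : ∃ i b, Chart i p b := by
  obtain ⟨i, hi⟩ := level_cases hp.2
  exact ⟨i, exists_chart_of_level hp hi⟩

/-! ### The horizontal twist -/

/-- The derivative of the horizontal twist. -/
def shear (u : ℂ) : ℂ := u + (φ / sn * u.im : ℝ)

/-- The horizontal twist in the strip over a cylinder. -/
def twist (i : Bool) (b : ℂ) : ℂ := b + (φ / sn * (b.im + hgt i / 2) : ℝ)

theorem twist_im (i : Bool) (b : ℂ) : (twist i b).im = b.im := by simp [twist]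

theorem twist_add (i : Bool) (b u : ℂ) (t : ℝ) :
    twist i (b + t * u) = twist i b + t * shear u := by
  apply Complex.ext <;> simp [twist, shear]; ring

theorem twist_deck (i : Bool) (b : ℂ) (c : ℝ) : twist i (b + c) = twist i b + c := by
  apply Complex.ext <;> simp [twist]; ring

/-- Both cylinders have the same ratio of circumference to height, so one shear makes exactly one
full turn in each. Everything about the twist rests on this coincidence. -/
theorem modulus (i : Bool) : φ / sn * hgt i = circ i := by
  have s0 := sn_ne; have s := sn_sq; have g := gold_sq
  rw [div_mul_eq_mul_div, div_eq_iff s0]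
  cases i <;> simp only [hgt, circ, cond]
  · linear_combination (-2 * φ) * s
  · linear_combination (-2 * (φ + 1)) * s + (3 / 2) * g

theorem twist_bottom {i : Bool} {b : ℂ} (h : b.im = -(hgt i / 2)) : twist i b = b := by
  simp [twist, h]

theorem twist_top {i : Bool} {b : ℂ} (h : b.im = hgt i / 2) :
    twist i b = b + ((1 : ℤ) * circ i : ℝ) := by
  rw [twist, h, add_halves, modulus]; simp

theorem exists_twist_eq (i : Bool) (b : ℂ) : ∃ b', twist i b' = b ∧ b'.im = b.im :=
  ⟨b - (φ / sn * (b.im + hgt i / 2) : ℝ), by simp [twist], by simp⟩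

/-- The point `q` is an image of `p` under the horizontal twist. -/
def Twisted (p q : ℝ × ℂ) : Prop := ∃ i b, Chart i p b ∧ Chart i q (twist i b)

theorem Twisted.exists {p : ℝ × ℂ} (hp : Valid p) : ∃ q, Twisted p q := by
  obtain ⟨i, b, h⟩ := exists_chart hp
  obtain ⟨q, hq⟩ := exists_chart_of_im (i := i) (b := twist i b) (by rw [twist_im]; exact h.im_le)
  exact ⟨q, i, b, h, hq⟩

theorem Twisted.exists_left {q : ℝ × ℂ} (hq : Valid q) : ∃ p, Twisted p q := by
  obtain ⟨i, b, h⟩ := exists_chart hq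
  obtain ⟨b', e, hb'⟩ := exists_twist_eq i b
  obtain ⟨p, hp⟩ := exists_chart_of_im (i := i) (b := b') (by rw [hb']; exact h.im_le)
  exact ⟨p, i, b', hp, e ▸ h⟩

/-- The twist fixes the boundaries of the cylinders. -/
theorem Chart.twist_boundary {i : Bool} {p q : ℝ × ℂ} {b v : ℂ} (h : Chart i p b)
    (hq : Chart i q (twist i b)) (hb : |b.im| = hgt i / 2) : Leaf v p q 0 := by
  have h0 := hgt_pos i
  rcases abs_cases b.im with ⟨e, _⟩ | ⟨e, _⟩
  · rw [twist_top (by rw [← e, hb])] at hq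
    exact (h.deck 1).leaf_zero hq
  · rw [twist_bottom (by linarith)] at hq
    exact h.leaf_zero hq

theorem Chart.im_eq {i : Bool} {p : ℝ × ℂ} {b : ℂ} (h : Chart i p b) :
    |b.im| = |p.2.im - ctr i| := by
  obtain ⟨k, rfl, h⟩ := h
  rw [tilePoint_im, abs_sg_mul]

/-- The two levels of the pentagon meet only at the height of the horizontal diagonal. -/
theorem Chart.boundary {i j : Bool} {p : ℝ × ℂ} {b b' : ℂ} (h : Chart i p b) (h' : Chart j p b')
    (hij : i ≠ j) : |b.im| = hgt i / 2 := by
  have g := gold_lower; have g' := gold_upper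
  have h1 := h.im_le
  have h2 := h'.im_le
  rw [h.im_eq] at h1 ⊢
  rw [h'.im_eq] at h2
  cases i <;> cases j <;> simp only [ctr, hgt, cond, ne_eq, not_true_eq_false] at *
  · rw [abs_le] at h1 h2
    rw [abs_of_nonpos] <;> linarith
  · rw [abs_le] at h1 h2
    rw [abs_of_nonneg] <;> linarith

/-- Two images in the same cylinder come from charts that differ by a deck translation, which
commutes with the twist. In different cylinders the point is on the common boundary, where the twist
is trivial. -/
theorem Twisted.unique {p q q' : ℝ × ℂ} {v : ℂ} (h : Twisted p q) (h' : Twisted p q') :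
    Leaf v q q' 0 := by
  obtain ⟨i, b, h1, h2⟩ := h
  obtain ⟨j, b', h1', h2'⟩ := h'
  by_cases hij : i = j
  · subst hij
    obtain ⟨m, rfl⟩ := h1.unique h1'
    rw [twist_deck] at h2'
    exact (h2.deck m).leaf_zero h2'
  · exact (h1.twist_boundary h2 (h1.boundary h1' hij)).symm_zero.trans_zero
      (h1'.twist_boundary h2' (h1'.boundary h1 (Ne.symm hij)))

/-- A straight line within one part of the pentagon. -/
theorem Twisted.leaf_of_chart {i : Bool} {p q p' q' : ℝ × ℂ} {b u : ℂ} {t : ℝ} (h : Chart i p b)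
    (h' : Chart i q (b + t * u)) (hp : Twisted p p') (hq : Twisted q q') :
    Leaf (shear u) p' q' t := by
  obtain ⟨p₁, h1⟩ := exists_chart_of_im (i := i) (b := twist i b) (by rw [twist_im]; exact h.im_le)
  obtain ⟨q₁, h2⟩ := exists_chart_of_im (i := i) (b := twist i (b + t * u))
    (by rw [twist_im]; exact h'.im_le)
  have e1 : Leaf (shear u) p' p₁ 0 := hp.unique ⟨i, b, h, h1⟩
  have e2 : Leaf (shear u) q₁ q' 0 := Twisted.unique ⟨i, _, h', h2⟩ hq
  exact e1.zero_trans ((h1.leaf h2 (twist_add i b u t)).trans_zero e2)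

theorem Twisted.leaf_move_level {i : Bool} {ε t : ℝ} {y u : ℂ} {p' q' : ℝ × ℂ} (hv : Valid (ε, y))
    (hz : y + ε * t * u ∈ pentagon) (h1 : |y.im - ctr i| ≤ hgt i / 2)
    (h2 : |(y + ε * t * u).im - ctr i| ≤ hgt i / 2)
    (hp : Twisted (ε, y) p') (hq : Twisted (ε, y + ε * t * u) q') : Leaf (shear u) p' q' t := by
  obtain ⟨b, k, e, hb⟩ := exists_chart_of_level (i := i) hv h1
  refine Twisted.leaf_of_chart (b := b) ⟨k, e, hb⟩ ⟨k, ?_, ?_⟩ hp hq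
  all_goals
    have e' : (ε, y + ε * t * u) = tilePoint i k (b + t * u) := by
      simp only [tilePoint, Prod.mk.injEq] at e ⊢
      refine ⟨e.1, ?_⟩
      rw [e.2, e.1]; ring
  · exact e'
  · rw [inTile_iff, ← e']
    exact ⟨h2, hz⟩

/-- A segment that changes its level is cut at height (φ - 1)/2 of the diagonal, which belongs to
both levels. -/
theorem Twisted.leaf_move {ε t : ℝ} {y u : ℂ} {p' q' : ℝ × ℂ} (hv : Valid (ε, y))
    (hz : y + ε * t * u ∈ pentagon)
    (hp : Twisted (ε, y) p') (hq : Twisted (ε, y + ε * t * u) q') : Leaf (shear u) p' q' t := by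
  obtain ⟨i, hi⟩ := level_cases hv.2
  obtain ⟨j, hj⟩ := level_cases hz
  by_cases hij : i = j
  · subst hij
    exact Twisted.leaf_move_level hv hz hi hj hp hq
  · have g := gold_lower; have g' := gold_upper
    obtain ⟨θ, t0, t1, hθ⟩ : ∃ θ : ℝ, 0 ≤ θ ∧ θ ≤ 1 ∧
        (y + ε * (θ * t : ℝ) * u).im = (φ - 1) / 2 := by
      have him : ∀ θ : ℝ, (y + ε * (θ * t : ℝ) * u).im =
          y.im + θ * ((y + ε * t * u).im - y.im) := by intro θ; simp; ring
      simp only [him]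
      rw [abs_le] at hi hj
      set a := y.im
      set c := (y + ε * t * u).im
      have hs : a ≤ (φ - 1) / 2 ∧ (φ - 1) / 2 ≤ c ∨ c ≤ (φ - 1) / 2 ∧ (φ - 1) / 2 ≤ a := by
        cases i <;> cases j <;> simp only [ctr, hgt, cond, not_true_eq_false] at *
        · right; constructor <;> linarith
        · left; constructor <;> linarith
      rcases eq_or_ne a c with e | e
      · refine ⟨0, le_rfl, zero_le_one, ?_⟩
        rcases hs with h | h <;> linarith
      · have hne : c - a ≠ 0 := sub_ne_zero.2 e.symm
        refine ⟨((φ - 1) / 2 - a) / (c - a), ?_, ?_, by rw [div_mul_cancel₀ _ hne]; ring⟩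
        · rcases hs with h | h
          · exact div_nonneg (by linarith) (by linarith)
          · exact div_nonneg_of_nonpos (by linarith) (by linarith)
        · rcases hs with h | h
          · have : 0 < c - a := lt_of_le_of_ne (by linarith) hne.symm
            rw [div_le_one this]; linarith
          · have : c - a < 0 := lt_of_le_of_ne (by linarith) hne
            rw [div_le_one_of_neg this]; linarith
    have hm : y + ε * (θ * t : ℝ) * u ∈ pentagon := by
      have := pentagon_convex hv.2 hz t0 t1
      convert this using 1; push_cast; ring
    have hl : ∀ k, |(y + ε * (θ * t : ℝ) * u).im - ctr k| ≤ hgt k / 2 := by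
      intro k
      rw [hθ, abs_le]
      cases k <;> simp only [ctr, hgt, cond] <;> constructor <;> linarith
    obtain ⟨r, hr⟩ := Twisted.exists (hv.move hm)
    have e : y + ε * t * u = y + ε * (θ * t : ℝ) * u + ε * (t - θ * t : ℝ) * u := by
      push_cast; ring
    rw [e] at hz hj hq
    have := (Twisted.leaf_move_level hv hm hi (hl i) hp hr).trans
      (Twisted.leaf_move_level (hv.move hm) hz (hl j) hj hr hq)
    rwa [add_sub_cancel] at this

theorem Twisted.leaf_boundary {p p' : ℝ × ℂ} {v : ℂ} {i : Bool} (h : Twisted p p')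
    (hp : Valid p) (hi : |p.2.im - ctr i| = hgt i / 2) : Leaf v p p' 0 := by
  obtain ⟨b, hb⟩ := exists_chart_of_level hp hi.le
  obtain ⟨q, hq⟩ := exists_chart_of_im (i := i) (b := twist i b) (by rw [twist_im]; exact hb.im_le)
  exact (hb.twist_boundary hq (by rw [hb.im_eq, hi])).trans_zero
    (Twisted.unique ⟨i, b, hb, hq⟩ h)

/-- The gluing along a slanted edge does not change the point of the strip. -/
theorem Chart.glue_side {i : Bool} {ε σ : ℝ} {y μ b : ℂ} (hσ : σ = 1 ∨ σ = -1)
    (hc : Chart i (ε, y) b) (hq : φ * μ - y ∈ pentagon)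
    (h1 : φ * μ.re = σ * (circ i / 2)) (h2 : φ * μ.im = 2 * ctr i) :
    Chart i (-ε, φ * μ - y) b := by
  have hl := hc.im_le
  rw [hc.im_eq] at hl
  obtain ⟨k, e, hk⟩ := hc
  simp only [tilePoint, Prod.mk.injEq] at e
  obtain ⟨e1, e2⟩ := e
  -- Here σ tells right from left in the pentagon; in the strip the two are exchanged when tile k is
  -- upside down, hence the product with `sg k`.
  have main : ∀ l : ℤ, sg l = -ε → (l : ℝ) = k + sg k * σ →
      Chart i (-ε, φ * μ - y) b := by
    intro l hl1 hl2
    have e' : (-ε, φ * μ - y) = tilePoint i l b := by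
      have hs := sg_mul_self k
      rw [e2]
      ext1
      · exact hl1.symm
      · apply Complex.ext
        · simp [tilePoint, h1, hl1, hl2, e1]; linear_combination (-σ * (circ i / 2)) * hs
        · simp [tilePoint, h2, hl1, e1]; ring
    refine ⟨l, e', ?_⟩
    rw [inTile_iff, ← e']
    refine ⟨?_, hq⟩
    have : (φ * μ - y).im - ctr i = -(y.im - ctr i) := by simp [h2]; ring
    rwa [this, abs_neg]
  have hp := sg_succ (k - 1)
  rw [sub_add_cancel] at hp
  rcases sg_cases k with h | h <;> rcases hσ with h' | h'
  · exact main (k + 1) (by rw [sg_succ, e1]) (by rw [h, h']; push_cast; ring)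
  · exact main (k - 1) (by rw [e1]; linarith) (by rw [h, h']; push_cast; ring)
  · exact main (k - 1) (by rw [e1]; linarith) (by rw [h, h']; push_cast; ring)
  · exact main (k + 1) (by rw [sg_succ, e1]) (by rw [h, h']; push_cast; ring)

theorem Twisted.leaf_glue_side {i : Bool} {ε σ : ℝ} {y μ u : ℂ} {p' q' : ℝ × ℂ}
    (hv : Valid (ε, y)) (hμ : IsNormal μ) (he : dot y μ = φ / 2) (hσ : σ = 1 ∨ σ = -1)
    (hl : |y.im - ctr i| ≤ hgt i / 2)
    (h1 : φ * μ.re = σ * (circ i / 2)) (h2 : φ * μ.im = 2 * ctr i)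
    (hp : Twisted (ε, y) p') (hq : Twisted (-ε, φ * μ - y) q') : Leaf (shear u) p' q' 0 := by
  obtain ⟨b, hb⟩ := exists_chart_of_level hv hl
  have hb' := hb.glue_side hσ (hv.glue hμ he).2 h1 h2
  exact Twisted.leaf_of_chart (t := 0) hb (by simpa using hb') hp hq

/-- Gluing along a slanted edge happens inside a cylinder and does not move the point of the strip.
The bottom edge and its mate lie on the boundary of the lower cylinder, where the twist is trivial.
-/
theorem Twisted.leaf_glue {ε : ℝ} {y μ u : ℂ} {p' q' : ℝ × ℂ} (hv : Valid (ε, y))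
    (hμ : IsNormal μ) (he : dot y μ = φ / 2)
    (hp : Twisted (ε, y) p') (hq : Twisted (-ε, φ * μ - y) q') : Leaf (shear u) p' q' 0 := by
  have g := gold_sq; have g1 := gold_lower; have g2 := gold_upper; have s0 := sn_pos
  obtain ⟨b1, b2, b3⟩ := mem_pentagon_iff.1 hv.2
  simp only at b1 b2 b3
  have lower : ∀ σ : ℝ, (σ = 1 ∨ σ = -1) → μ = ⟨σ * (φ * sn), -((φ - 1) / 2)⟩ →
      Leaf (shear u) p' q' 0 := by
    intro σ hσ h
    have ha : σ * y.re ≤ |y.re| := by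
      rcases hσ with rfl | rfl
      · simpa using le_abs_self y.re
      · simpa using neg_abs_le y.re |>.trans' (by simp)|> neg_le.1
    rw [h, dot] at he
    simp only at he
    -- The inequality of the upper edge on the same side, combined with the equation of the lower
    -- edge, puts y below the diagonal.
    have h4 : φ * (σ * y.re * sn + y.im * (φ / 2)) ≤ φ * (φ / 2) := by
      apply mul_le_mul_of_nonneg_left _ gold_pos.le
      have := mul_le_mul_of_nonneg_right ha s0.le
      linarith
    refine Twisted.leaf_glue_side (i := true) hv hμ (by rw [h]; exact he) hσ ?_ ?_ ?_ hp hq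
    · rw [abs_le]; simp only [ctr, hgt, cond]; constructor
      · linarith
      · nlinarith
    · rw [h]; simp only [circ, cond]; linear_combination σ * sn * g
    · rw [h]; simp only [ctr, cond]; linear_combination (-1 / 2) * g
  have upper : ∀ σ : ℝ, (σ = 1 ∨ σ = -1) → μ = ⟨σ * sn, φ / 2⟩ → Leaf (shear u) p' q' 0 := by
    intro σ hσ h
    have ha : σ * y.re ≤ |y.re| := by
      rcases hσ with rfl | rfl
      · simpa using le_abs_self y.re
      · simpa using neg_abs_le y.re |>.trans' (by simp)|> neg_le.1
    rw [h, dot] at he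
    simp only at he
    have h5 := mul_nonneg (abs_nonneg y.re) s0.le
    have h4 := mul_le_mul_of_nonneg_right ha (mul_pos gold_pos s0).le
    have h6 : φ * (y.re * (σ * sn) + y.im * (φ / 2)) = φ * (φ / 2) := by rw [he]
    refine Twisted.leaf_glue_side (i := false) hv hμ (by rw [h]; exact he) hσ ?_ ?_ ?_ hp hq
    · rw [abs_le]; simp only [ctr, hgt, cond]; constructor
      · nlinarith
      · nlinarith
    · rw [h]; simp only [circ, cond]; ring
    · rw [h]; simp only [ctr, cond]; linear_combination (1 / 2) * g
  rcases hμ.cases with h | h | h | h | h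
  · have hl : ∀ z : ℂ, z.im = -(φ / 2) → |z.im - ctr true| = hgt true / 2 := by
      intro z hz
      rw [hz]; simp only [ctr, hgt, cond]
      rw [abs_of_nonpos] <;> linarith
    have hy : y.im = -(φ / 2) := by
      rw [h] at he; simp [dot] at he; linarith
    exact (hp.leaf_boundary hv (hl _ hy)).symm_zero.trans_zero ((Leaf.glue hv hμ he).trans_zero
      (hq.leaf_boundary (hv.glue hμ he) (hl _ (by rw [h]; simp [hy]; ring))))
  · exact lower 1 (by simp) (by rw [h]; simp)
  · exact lower (-1) (by simp) (by rw [h]; simp)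
  · exact upper 1 (by simp) (by rw [h]; simp)
  · exact upper (-1) (by simp) (by rw [h]; simp)

/-- The horizontal twist takes leaves to leaves. -/
theorem Leaf.twisted {u : ℂ} {p q : ℝ × ℂ} {t : ℝ} (h : Leaf u p q t) :
    ∀ {p' q' : ℝ × ℂ}, Twisted p p' → Twisted q q' → Leaf (shear u) p' q' t := by
  induction h with
  | move hv hz => exact fun hp hq => Twisted.leaf_move hv hz hp hq
  | glue hv hμ he => exact fun hp hq => Twisted.leaf_glue hv hμ he hp hq
  | symm _ ih => exact fun hp hq => (ih hq hp).symm
  | trans h1 _ ih ih' =>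
    intro p' q' hp hq
    obtain ⟨r, hr⟩ := Twisted.exists h1.valid.2
    exact (ih hp hr).trans (ih' hr hq)

/-! ### Directions in which all leaves are closed -/

/-- All leaves in direction `u` close up after the time `circ true` or `circ false`. -/
def Closes (u : ℂ) : Prop := ∀ p, Valid p → ∃ i, Leaf u p p (circ i)

theorem closes_one : Closes 1 := by
  intro p hp
  obtain ⟨i, b, h⟩ := exists_chart hp
  exact ⟨i, h.leaf (h.deck 1) (by simp)⟩

/-- The twist pushes a closed leaf through a preimage p forward to a closed leaf through q; the time
is unchanged, since only the direction vector is sheared. -/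
theorem Closes.shear {u : ℂ} (h : Closes u) : Closes (shear u) := by
  intro q hq
  obtain ⟨p, hp⟩ := Twisted.exists_left hq
  obtain ⟨i, b, hb, -⟩ := id hp
  obtain ⟨j, hj⟩ := h p hb.valid
  exact ⟨j, hj.twisted hp hp⟩

/-- Multiplication by ω exchanges the two copies: ω(εy) = (-ε)(-ωy), where -ω is a fifth root of
unity and so preserves the pentagon. -/
theorem Leaf.rotate {u : ℂ} {p q : ℝ × ℂ} {t : ℝ} (h : Leaf u p q t) :
    Leaf (omega * u) (-p.1, -omega * p.2) (-q.1, -omega * q.2) t := by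
  have h5 : (-omega) ^ 5 = 1 := by rw [Odd.neg_pow (by decide), omega_pow_five]; norm_num
  have hv : ∀ p : ℝ × ℂ, Valid p → Valid (-p.1, -omega * p.2) := by
    intro p hp
    refine ⟨?_, root_mul_mem_pentagon h5 hp.2⟩
    rcases hp.1 with h | h <;> simp [h]
  induction h with
  | @move ε y t h h' =>
    have e : -omega * (y + ε * t * u) = -omega * y + (-ε : ℝ) * t * (omega * u) := by
      push_cast; ring
    have h2 := root_mul_mem_pentagon h5 h'
    simp only
    rw [e] at h2 ⊢
    exact Leaf.move (hv _ h) h2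
  | @glue ε y μ h hμ he =>
    have e : -omega * (φ * μ - y) = φ * (-omega * μ) - -omega * y := by ring
    simp only
    rw [e]
    refine Leaf.glue (hv _ h) (hμ.root_mul h5) ?_
    rw [dot_unit_mul (mul_conj_of_pow_eq (by norm_num) h5 (by simp)), he]
  | symm _ ih => exact ih.symm
  | trans _ _ ih ih' => exact ih.trans ih'

theorem Closes.rotate {u : ℂ} (h : Closes u) : Closes (omega * u) := by
  intro p hp
  have h5 := omega_pow_five
  have h6 : (omega ^ 4) ^ 5 = 1 := by rw [← pow_mul, mul_comm, pow_mul, h5]; norm_num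
  -- This point is the preimage of p under the rotation, because -ω · ω⁴ = 1.
  have hv : Valid (-p.1, omega ^ 4 * p.2) := by
    refine ⟨?_, root_mul_mem_pentagon h6 hp.2⟩
    rcases hp.1 with h | h <;> simp [h]
  obtain ⟨i, hi⟩ := h _ hv
  have := hi.rotate
  have e : -omega * (omega ^ 4 * p.2) = p.2 := by linear_combination (-p.2) * h5
  simp only [neg_neg, e] at this
  exact ⟨i, this⟩

theorem Closes.rotate_pow {u : ℂ} (h : Closes u) (k : ℕ) : Closes (omega ^ k * u) := by
  induction k with
  | zero => simpa using h
  | succ k ih => rw [pow_succ', mul_assoc]; exact ih.rotate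

theorem pentagonVector_eq (w : List (Fin 4)) :
    pentagonVector w = treeVector w 0 + treeVector w 1 * omega := by
  apply Complex.ext
  · simp [pentagonVector, stretch, Matrix.mulVec, dotProduct, Fin.sum_univ_two, omega, cos_eq,
      -Real.cos_pi_div_five]
    ring
  · simp [pentagonVector, stretch, Matrix.mulVec, dotProduct, Fin.sum_univ_two, omega, sn]
    ring

theorem treeVector_append (w : List (Fin 4)) (k : Fin 4) :
    treeVector (w ++ [k]) = (sigma k).mulVec (treeVector w) := by
  simp [treeVector]

theorem shear_eq (x y : ℝ) : shear (x + y * omega) = (x + φ * y : ℝ) + y * omega := by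
  have := sn_ne
  apply Complex.ext <;> simp [shear, omega]
  field_simp
  ring

/-- In coordinates with respect to 1, ω, multiplication by ω is (x, y) ↦ (-y, x + φy) and the shear
is (x, y) ↦ (x + φy, y). -/
theorem pentagonVector_append (w : List (Fin 4)) (k : Fin 4) :
    pentagonVector (w ++ [k]) = shear (omega ^ (k : ℕ) * pentagonVector w) := by
  rw [pentagonVector_eq, pentagonVector_eq, treeVector_append]
  generalize treeVector w = v
  have mul : ∀ x y : ℝ, omega * (x + y * omega) = (-y : ℝ) + (x + φ * y : ℝ) * omega := by
    intro x y
    push_cast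
    linear_combination (y : ℂ) * omega_sq_eq
  have g := gold_sq_complex
  have gg : Real.goldenRatio = φ := rfl
  fin_cases k
  · simp [sigma, Matrix.mulVec, dotProduct, Fin.sum_univ_two, shear_eq, gg]
  · simp only [Fin.mk_one, pow_one, mul, shear_eq]
    simp [sigma, Matrix.mulVec, dotProduct, Fin.sum_univ_two, gg]
    linear_combination (-(v 1 : ℂ)) * g
  · simp only [Fin.reduceFinMk, pow_two, mul_assoc, mul, shear_eq]
    simp [sigma, Matrix.mulVec, dotProduct, Fin.sum_univ_two, gg]
    linear_combination (-(v 0 : ℂ) - v 1 * omega - (φ + 1) * v 1) * g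
  · simp only [Fin.reduceFinMk, pow_succ, pow_zero, one_mul, mul_assoc, mul,
      shear_eq]
    simp [sigma, Matrix.mulVec, dotProduct, Fin.sum_univ_two, gg]
    linear_combination (-((φ + 1) * v 0 : ℂ) - v 0 * omega - (φ + 1) * v 1 * omega -
      (φ ^ 2 + φ - 1) * v 1) * g

theorem closes_pentagonVector (w : List (Fin 4)) : Closes (pentagonVector w) := by
  induction w using List.reverseRecOn with
  | nil =>
    have : pentagonVector [] = 1 := by simp [pentagonVector_eq, treeVector]
    rw [this]
    exact closes_one
  | append_singleton w k ih =>
    rw [pentagonVector_append]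
    exact (ih.rotate_pow k).shear

/-! ### The geometry of a billiard trajectory -/

/-- The primitive fifth root of unity. -/
def zeta : ℂ := omega ^ 2

theorem zeta_pow_five : zeta ^ 5 = 1 := by
  rw [zeta, ← pow_mul, mul_comm, pow_mul, omega_pow_five]; norm_num

theorem zeta_ne_zero : zeta ≠ 0 := by
  intro h
  have := zeta_pow_five
  rw [h] at this
  norm_num at this

theorem zeta_ne_one : zeta ≠ 1 := by
  intro h
  have := congrArg Complex.im h
  rw [zeta, omega_sq] at this
  simp [gold_pos.ne', sn_ne] at this

theorem orderOf_zeta : orderOf zeta = 5 :=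
  have : Fact (Nat.Prime 5) := ⟨by norm_num⟩
  orderOf_eq_prime zeta_pow_five zeta_ne_one

theorem omega_mul_conj : omega * conj omega = 1 :=
  mul_conj_of_pow_eq (by norm_num) omega_pow_five (by simp)

theorem zeta_mul_conj : zeta * conj zeta = 1 :=
  mul_conj_of_pow_eq (by norm_num) zeta_pow_five (by simp)

theorem omega_eq : omega = -zeta ^ 3 := by
  unfold zeta
  linear_combination omega * omega_pow_five

theorem vertex_eq (k : ℕ) : vertex k = I * zeta ^ k := by
  rw [vertex, exp_eq_omega_sq, zeta]

/-- The outward unit normal of the edge from `vertex k` to `vertex (k + 1)`. -/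
def edgeNormal (k : ℕ) : ℂ := -I * zeta ^ (k + 3)

theorem isNormal_edgeNormal (k : ℕ) : IsNormal (edgeNormal k) :=
  isNormal_of_root (by rw [← pow_mul, mul_comm, pow_mul, zeta_pow_five, one_pow]) rfl

theorem vertex_eq_mul (k : ℕ) : vertex k = edgeNormal k * conj omega := by
  have h := omega_mul_conj
  have h' := omega_eq
  rw [vertex_eq, edgeNormal, pow_add]
  linear_combination (-I * zeta ^ k) * h + (I * zeta ^ k * conj omega) * h'

theorem vertex_succ_eq_mul (k : ℕ) : vertex (k + 1) = edgeNormal k * omega := by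
  have h' := omega_eq
  rw [vertex_eq, edgeNormal, pow_add, pow_add, zeta] at *
  linear_combination (I * (omega ^ 2) ^ k * omega) * h'

theorem edge_dot {k : ℕ} {z : ℂ} (hz : z ∈ openSegment ℝ (vertex k) (vertex (k + 1))) :
    dot z (edgeNormal k) = φ / 2 ∧ ∀ ν, IsNormal ν → ν ≠ edgeNormal k → dot z ν < φ / 2 := by
  obtain ⟨a, b, ha, hb, hab, rfl⟩ := hz
  have hμ := isNormal_edgeNormal k
  set μ := edgeNormal k with hdef
  -- In the frame of the normal, the edge is the vertical segment at distance φ/2 from the centre,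
  -- of half-length `sn`. The other normals become the nontrivial fifth roots of unity.
  have hz : a • vertex k + b • vertex (k + 1) = μ * ⟨φ / 2, (b - a) * sn⟩ := by
    rw [vertex_eq_mul, vertex_succ_eq_mul, ← hdef]
    have : (⟨φ / 2, (b - a) * sn⟩ : ℂ) = a * conj omega + b * omega := by
      apply Complex.ext <;> simp [omega]
      · rw [← add_mul, hab, one_mul]
      · ring
    rw [this, real_smul, real_smul]; ring
  rw [hz]
  have hd : ∀ ν, dot (μ * ⟨φ / 2, (b - a) * sn⟩) ν = dot ⟨φ / 2, (b - a) * sn⟩ (conj μ * ν) := by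
    intro ν
    have h1 := hμ.mul_conj
    conv_lhs => rw [← one_mul ν, ← h1, mul_assoc, dot_unit_mul h1]
  have hs := sn_sq; have g := gold_sq; have g1 := gold_lower; have g2 := gold_upper
  refine ⟨?_, fun ν hν hne => ?_⟩
  · rw [hd, mul_comm (conj μ), hμ.mul_conj]; simp [dot]
  · rw [hd]
    have h5 : (conj μ * ν) ^ 5 = 1 := by
      unfold IsNormal at hμ hν
      rw [mul_pow, ← map_pow, hμ, hν]; simp
    have hb1 : -1 < b - a := by linarith
    have hb2 : b - a < 1 := by linarith
    rcases fifth_root_cases h5 with h | h | h | h | h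
    · exfalso
      apply hne
      linear_combination μ * h - ν * hμ.mul_conj
    all_goals
      rw [h, dot]; simp only
    · have : φ / 2 * ((φ - 1) / 2) + (b - a) * sn * (φ * sn) =
          φ / 2 * ((φ - 1) / 2 + (b - a) * ((3 - φ) / 2)) := by
        linear_combination (b - a) * φ * hs
      rw [this]
      nlinarith
    · have : φ / 2 * ((φ - 1) / 2) + (b - a) * sn * (-(φ * sn)) =
          φ / 2 * ((φ - 1) / 2 - (b - a) * ((3 - φ) / 2)) := by
        linear_combination (-(b - a)) * φ * hs
      rw [this]
      nlinarith
    · have : φ / 2 * (-(φ / 2)) + (b - a) * sn * sn =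
          -(φ ^ 2 / 4) + (b - a) * ((3 - φ) / 4) := by
        linear_combination (b - a) * hs
      rw [this]
      nlinarith
    · have : φ / 2 * (-(φ / 2)) + (b - a) * sn * -sn =
          -(φ ^ 2 / 4) - (b - a) * ((3 - φ) / 4) := by
        linear_combination (-(b - a)) * hs
      rw [this]
      nlinarith

theorem edgeNormal_ne {e f : Fin 5} (h : e ≠ f) : edgeNormal e ≠ edgeNormal f := by
  intro h'
  apply h
  have h1 : zeta ^ ((e : ℕ) + 3) = zeta ^ ((f : ℕ) + 3) :=
    mul_left_cancel₀ (neg_ne_zero.2 I_ne_zero) h'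
  rw [pow_add, pow_add] at h1
  have h2 := mul_right_cancel₀ (pow_ne_zero 3 zeta_ne_zero) h1
  refine Fin.ext (pow_injOn_Iio_orderOf ?_ ?_ h2) <;> rw [orderOf_zeta] <;> simp

/-- The reflection in the line of an edge is the negative of the reflection in the perpendicular
axis, and the latter is a symmetry of the pentagon. -/
theorem edge_reflection (k : ℕ) (d : ℂ) :
    (Submodule.span ℝ {vertex (k + 1) - vertex k}).reflection d = -mirror (edgeNormal k) d := by
  have hs := sn_ne
  have hμ := isNormal_edgeNormal k
  have hv : vertex (k + 1) - vertex k = (2 * sn : ℝ) * (edgeNormal k * I) := by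
    rw [vertex_succ_eq_mul, vertex_eq_mul, ← mul_sub]
    have : omega - conj omega = (2 * sn : ℝ) * I := by
      apply Complex.ext <;> simp [omega]; ring
    rw [this]; ring
  set μ := edgeNormal k
  have h1 := hμ.dot_self
  have hn : ‖μ * I‖ = 1 := by
    rw [norm_mul, norm_I, mul_one]
    have := hμ.mul_conj
    rw [mul_conj, normSq_eq_norm_sq] at this
    have h2 : ‖μ‖ ^ 2 = 1 := by exact_mod_cast this
    exact (pow_eq_one_iff_of_nonneg (norm_nonneg μ) two_ne_zero).1 h2
  have hspan : Submodule.span ℝ {vertex (k + 1) - vertex k} = Submodule.span ℝ {μ * I} := by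
    rw [hv, ← real_smul]
    exact Submodule.span_singleton_smul_eq (isUnit_iff_ne_zero.2 (by positivity)) _
  have key : ∀ (K : Submodule ℝ ℂ) [K.HasOrthogonalProjection], K = Submodule.span ℝ {μ * I} →
      K.reflection d = (Submodule.span ℝ {μ * I}).reflection d := by
    rintro K _ rfl; rfl
  rw [key _ hspan, Submodule.reflection_singleton_apply, hn, mirror_eq hμ]
  simp only [dot] at h1
  apply Complex.ext <;> simp [dot]
  · linear_combination (2 * d.re) * h1
  · linear_combination (2 * d.im) * h1

namespace Trajectory

variable (τ : Trajectory)

/-- The outward normal of the edge at the `n`-th bounce. -/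
def nrm (n : ℤ) : ℂ := edgeNormal (τ.edge n)

/-- The direction of motion after the `n`-th bounce. -/
def dir (n : ℤ) : ℂ := unitDirection (τ.pt n) (τ.pt (n + 1))

/-- The length of the segment after the `n`-th bounce. -/
def len (n : ℤ) : ℝ := ‖τ.pt (n + 1) - τ.pt n‖

theorem isNormal_nrm (n : ℤ) : IsNormal (τ.nrm n) := isNormal_edgeNormal _

theorem dot_pt (n : ℤ) : dot (τ.pt n) (τ.nrm n) = φ / 2 := (edge_dot (τ.pt_mem n)).1

theorem dot_pt_lt (n : ℤ) {ν : ℂ} (h : IsNormal ν) (hne : ν ≠ τ.nrm n) :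
    dot (τ.pt n) ν < φ / 2 := (edge_dot (τ.pt_mem n)).2 ν h hne

theorem nrm_succ_ne (n : ℤ) : τ.nrm (n + 1) ≠ τ.nrm n := edgeNormal_ne (τ.edge_ne n)

theorem pt_mem_pentagon (n : ℤ) : τ.pt n ∈ pentagon := by
  intro ν hν
  by_cases h : ν = τ.nrm n
  · rw [h, τ.dot_pt]
  · exact (τ.dot_pt_lt n hν h).le

theorem pt_succ_ne (n : ℤ) : τ.pt (n + 1) ≠ τ.pt n := by
  intro h
  have h1 := τ.dot_pt_lt n (τ.isNormal_nrm (n + 1)) (τ.nrm_succ_ne n)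
  rw [← h, τ.dot_pt] at h1
  exact lt_irrefl _ h1

theorem len_pos (n : ℤ) : 0 < τ.len n := norm_pos_iff.2 (sub_ne_zero.2 (τ.pt_succ_ne n))

theorem pt_succ (n : ℤ) : τ.pt (n + 1) = τ.pt n + τ.len n * τ.dir n := by
  have : (τ.len n : ℂ) ≠ 0 := by exact_mod_cast (τ.len_pos n).ne'
  unfold dir unitDirection
  rw [← len, mul_div_cancel₀ _ this]; ring

theorem norm_dir (n : ℤ) : ‖τ.dir n‖ = 1 := by
  unfold dir unitDirection
  rw [norm_div, norm_real, norm_norm, div_self]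
  exact (τ.len_pos n).ne'

theorem dir_succ (n : ℤ) : τ.dir (n + 1) = -mirror (τ.nrm (n + 1)) (τ.dir n) := by
  have := τ.reflect (n + 1)
  rw [edge_reflection, add_sub_cancel_right] at this
  exact this

theorem mirror_dir_succ (n : ℤ) : mirror (τ.nrm (n + 1)) (τ.dir (n + 1)) = -τ.dir n := by
  rw [dir_succ]
  conv_rhs => rw [← mirror_mirror (τ.isNormal_nrm (n + 1)) (τ.dir n)]
  simp only [mirror, map_neg]; ring

theorem mirror_dir (n : ℤ) : mirror (τ.nrm n) (τ.dir n) = -τ.dir (n - 1) := by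
  have := τ.mirror_dir_succ (n - 1)
  rwa [sub_add_cancel] at this

theorem dot_dir_nrm (n : ℤ) : dot (τ.dir n) (τ.nrm n) < 0 := by
  have h1 := τ.dot_pt_lt (n + 1) (τ.isNormal_nrm n) (τ.nrm_succ_ne n).symm
  rw [τ.pt_succ, dot_add_left, dot_real_mul_left, τ.dot_pt] at h1
  have := τ.len_pos n
  by_contra! h
  nlinarith

theorem dot_dir_nrm_succ (n : ℤ) : 0 < dot (τ.dir n) (τ.nrm (n + 1)) := by
  have h1 := τ.dot_pt_lt n (τ.isNormal_nrm (n + 1)) (τ.nrm_succ_ne n)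
  have h2 := τ.dot_pt (n + 1)
  rw [τ.pt_succ, dot_add_left, dot_real_mul_left] at h2
  have := τ.len_pos n
  by_contra! h
  nlinarith

/-- The line of a segment meets the pentagon in that segment. -/
theorem mem_chord {n : ℤ} {t : ℝ} (h : τ.pt n + t * τ.dir n ∈ pentagon) :
    0 ≤ t ∧ t ≤ τ.len n := by
  constructor
  · have h1 := h _ (τ.isNormal_nrm n)
    rw [dot_add_left, dot_real_mul_left, τ.dot_pt] at h1
    have := τ.dot_dir_nrm n
    by_contra! h2
    nlinarith
  · have h1 := h _ (τ.isNormal_nrm (n + 1))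
    have h2 := τ.dot_pt (n + 1)
    rw [τ.pt_succ, dot_add_left, dot_real_mul_left] at h2
    rw [dot_add_left, dot_real_mul_left] at h1
    have := τ.dot_dir_nrm_succ n
    by_contra! h3
    nlinarith

/-- A segment meets the edges only in its end points. -/
theorem chord_edge {n : ℤ} {t : ℝ} (h0 : 0 ≤ t) (h1 : t ≤ τ.len n) {ν : ℂ} (hν : IsNormal ν)
    (h : dot (τ.pt n + t * τ.dir n) ν = φ / 2) :
    (t = 0 ∧ ν = τ.nrm n) ∨ (t = τ.len n ∧ ν = τ.nrm (n + 1)) := by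
  have hl := τ.len_pos n
  have ha := τ.pt_mem_pentagon n ν hν
  have hb := τ.pt_mem_pentagon (n + 1) ν hν
  have hc := h
  rw [dot_add_left, dot_real_mul_left] at hc
  rw [τ.pt_succ, dot_add_left, dot_real_mul_left] at hb
  by_cases e0 : t = 0
  · left
    refine ⟨e0, ?_⟩
    by_contra hne
    have := τ.dot_pt_lt n hν hne
    rw [e0] at hc; linarith
  · by_cases e1 : t = τ.len n
    · right
      refine ⟨e1, ?_⟩
      by_contra hne
      have := τ.dot_pt_lt (n + 1) hν hne
      rw [e1, ← τ.pt_succ] at h; linarith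
    · exfalso
      have t0 : 0 < t := lt_of_le_of_ne h0 (Ne.symm e0)
      have t1 : t < τ.len n := lt_of_le_of_ne h1 e1
      -- An affine function that attains its maximum inside the segment is constant on it; then ν
      -- would be the normal of the edge that the segment leaves transversally.
      have hd : dot (τ.dir n) ν = 0 := by
        apply le_antisymm
        · by_contra! h3; nlinarith
        · by_contra! h3; nlinarith
      rw [hd] at hc
      have e2 : ν = τ.nrm n := by
        by_contra hne
        have := τ.dot_pt_lt n hν hne
        linarith
      have := τ.dot_dir_nrm n
      rw [← e2] at this
      linarith

/-- The trajectory traversed backwards. -/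
def rev : Trajectory where
  pt n := τ.pt (-n)
  edge n := τ.edge (-n)
  pt_mem n := τ.pt_mem (-n)
  edge_ne n := by
    have := τ.edge_ne (-(n + 1))
    rw [show -(n + 1) + 1 = -n by ring] at this
    exact this.symm
  reflect n := by
    have h := τ.reflect (-n)
    have anti : ∀ x y : ℂ, unitDirection x y = -unitDirection y x := by
      intro x y
      unfold unitDirection
      rw [norm_sub_rev]; ring
    rw [anti (τ.pt (-n)), show -(n + 1) = -n - 1 by ring, anti (τ.pt (-(n - 1))),
      show -(n - 1) = -n + 1 by ring, map_neg, h, Submodule.reflection_reflection]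

theorem rev_dir (n : ℤ) : τ.rev.dir n = -τ.dir (-n - 1) := by
  unfold dir rev unitDirection
  simp only
  rw [show -(n + 1) = -n - 1 by ring, norm_sub_rev, sub_add_cancel]; ring

/-- The motion is determined by a position and a direction. -/
theorem forward_step {τ τ' : Trajectory} {a : ℂ} (ha : a ^ 5 = 1) {m n : ℤ}
    (hp : τ'.pt m = a * τ.pt n) (hd : τ'.dir m = a * τ.dir n) :
    τ'.pt (m + 1) = a * τ.pt (n + 1) ∧ τ'.dir (m + 1) = a * τ.dir (n + 1) := by
  have hc : a * conj a = 1 := mul_conj_of_pow_eq (by norm_num) ha (by simp)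
  have ha' : (conj a) ^ 5 = 1 := by rw [← map_pow, ha, map_one]
  -- The rotated chord lies in the pentagon along the chord of τ'; the same comparison with the
  -- inverse rotation gives equal lengths.
  have h1 : τ.len n ≤ τ'.len m := by
    refine (τ'.mem_chord (n := m) (t := τ.len n) ?_).2
    have := root_mul_mem_pentagon ha (τ.pt_mem_pentagon (n + 1))
    rw [hp, hd]
    rw [τ.pt_succ] at this
    convert this using 1; ring
  have h2 : τ'.len m ≤ τ.len n := by
    refine (τ.mem_chord (n := n) (t := τ'.len m) ?_).2
    have := root_mul_mem_pentagon ha' (τ'.pt_mem_pentagon (m + 1))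
    rw [τ'.pt_succ, hp, hd] at this
    convert this using 1
    linear_combination (-(τ.pt n + τ'.len m * τ.dir n)) * hc
  have h3 : τ'.pt (m + 1) = a * τ.pt (n + 1) := by
    rw [τ'.pt_succ, τ.pt_succ, hp, hd, le_antisymm h1 h2]; ring
  refine ⟨h3, ?_⟩
  have h4 : a * τ.nrm (n + 1) = τ'.nrm (m + 1) := by
    by_contra hne
    have := τ'.dot_pt_lt (m + 1) ((τ.isNormal_nrm (n + 1)).root_mul ha) hne
    rw [h3, dot_unit_mul hc, τ.dot_pt] at this
    exact lt_irrefl _ this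
  rw [dir_succ, dir_succ, ← h4, hd]
  simp only [mirror, map_mul]
  linear_combination (-a * (τ.nrm (n + 1)) ^ 2 * conj (τ.dir n)) * hc

theorem forward {τ τ' : Trajectory} {a : ℂ} (ha : a ^ 5 = 1) {m n : ℤ}
    (hp : τ'.pt m = a * τ.pt n) (hd : τ'.dir m = a * τ.dir n) (i : ℕ) :
    τ'.pt (m + i) = a * τ.pt (n + i) ∧ τ'.dir (m + i) = a * τ.dir (n + i) := by
  induction i with
  | zero => simpa using ⟨hp, hd⟩
  | succ i ih =>
    have := forward_step ha ih.1 ih.2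
    push_cast
    rw [← add_assoc, ← add_assoc]
    exact this

theorem nrm_of_pt {τ τ' : Trajectory} {a : ℂ} (ha : a ^ 5 = 1) {m n : ℤ}
    (hp : τ'.pt m = a * τ.pt n) : τ'.nrm m = a * τ.nrm n := by
  have hc : a * conj a = 1 := mul_conj_of_pow_eq (by norm_num) ha (by simp)
  by_contra hne
  have := τ'.dot_pt_lt m ((τ.isNormal_nrm n).root_mul ha) (Ne.symm hne)
  rw [hp, dot_unit_mul hc, τ.dot_pt] at this
  exact lt_irrefl _ this

theorem determined {τ τ' : Trajectory} {a : ℂ} (ha : a ^ 5 = 1) {m n : ℤ}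
    (hp : τ'.pt m = a * τ.pt n) (hd : τ'.dir m = a * τ.dir n) (i : ℤ) :
    τ'.pt (m + i) = a * τ.pt (n + i) := by
  rcases Int.eq_nat_or_neg i with ⟨k, rfl | rfl⟩
  · exact (forward ha hp hd k).1
  -- The past is the future of the reversed trajectories; their directions at the bounce are
  -- obtained by the law of reflection.
  · have hc : a * conj a = 1 := mul_conj_of_pow_eq (by norm_num) ha (by simp)
    have hp' : τ'.rev.pt (-m) = a * τ.rev.pt (-n) := by simpa [rev] using hp
    have hd' : τ'.rev.dir (-m) = a * τ.rev.dir (-n) := by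
      rw [rev_dir, rev_dir, neg_neg, neg_neg, ← mirror_dir, ← mirror_dir, hd, nrm_of_pt ha hp]
      simp only [mirror, map_mul]
      linear_combination (a * (τ.nrm n) ^ 2 * conj (τ.dir n)) * hc
    have := (forward ha hp' hd' k).1
    simpa [rev, add_comm] using this

end Trajectory

/-! ### Reduction of the lattice of holonomies -/

/-- The real number `x` lies in `ℤ[φ]` and its residue modulo `√5` is `m`. -/
def Residue (x : ℝ) (m : ZMod 5) : Prop := ∃ a b : ℤ, x = a + b * φ ∧ m = a + 3 * b

/-- By irrationality of φ the coordinates in ℤ[φ] are unique. -/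
theorem Residue.unique {x : ℝ} {m n : ZMod 5} (h : Residue x m) (h' : Residue x n) : m = n := by
  obtain ⟨a, b, rfl, rfl⟩ := h
  obtain ⟨c, d, e, rfl⟩ := h'
  have hb : b = d := by
    by_contra hne
    have h1 : ((b - d : ℤ) : ℝ) * φ = ((c - a : ℤ) : ℝ) := by push_cast; linear_combination e
    have h2 : Irrational φ := Real.goldenRatio_irrational
    have h3 := h2.intCast_mul (sub_ne_zero.2 hne)
    rw [h1] at h3
    exact (c - a).not_irrational h3
  subst hb
  have : (a : ℝ) = c := by linarith
  rw [Int.cast_injective this]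

theorem residue_one : Residue 1 1 := ⟨1, 0, by simp, by simp⟩

theorem residue_zero : Residue 0 0 := ⟨0, 0, by simp, by simp⟩

/-- Since 2φ - 1 = √5, the residue of φ is 1/2 = 3 in 𝔽₅. -/
theorem residue_gold : Residue φ 3 := ⟨0, 1, by simp, by simp⟩

theorem Residue.add {x y : ℝ} {m n : ZMod 5} (h : Residue x m) (h' : Residue y n) :
    Residue (x + y) (m + n) := by
  obtain ⟨a, b, rfl, rfl⟩ := h
  obtain ⟨c, d, rfl, rfl⟩ := h'
  exact ⟨a + c, b + d, by push_cast; ring, by push_cast; ring⟩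

theorem Residue.neg {x : ℝ} {m : ZMod 5} (h : Residue x m) : Residue (-x) (-m) := by
  obtain ⟨a, b, rfl, rfl⟩ := h
  exact ⟨-a, -b, by push_cast; ring, by push_cast; ring⟩

theorem Residue.mul {x y : ℝ} {m n : ZMod 5} (h : Residue x m) (h' : Residue y n) :
    Residue (x * y) (m * n) := by
  obtain ⟨a, b, rfl, rfl⟩ := h
  obtain ⟨c, d, rfl, rfl⟩ := h'
  refine ⟨a * c + b * d, a * d + b * c + b * d, ?_, ?_⟩
  · push_cast; linear_combination (b * d : ℝ) * gold_sq
  · have h5 : (5 : ZMod 5) = 0 := rfl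
    push_cast
    linear_combination (b * d : ZMod 5) * h5

/-- The complex number `z` lies in `ℤ[ζ]` and its residue modulo `1 - ζ` is `j`. -/
def LatticeResidue (z : ℂ) (j : ZMod 5) : Prop :=
  ∃ (x y : ℝ) (m n : ZMod 5), Residue x m ∧ Residue y n ∧ z = x + y * omega ∧ j = m - n

theorem add_mul_omega_inj {x y x' y' : ℝ} (h : (x : ℂ) + y * omega = x' + y' * omega) :
    x = x' ∧ y = y' := by
  have h1 := congrArg Complex.im h
  have h2 := congrArg Complex.re h
  simp [omega] at h1 h2
  have : y = y' := h1.resolve_right sn_ne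
  subst this
  exact ⟨by linarith, rfl⟩

theorem LatticeResidue.unique {z : ℂ} {j k : ZMod 5} (h : LatticeResidue z j)
    (h' : LatticeResidue z k) : j = k := by
  obtain ⟨x, y, m, n, hx, hy, rfl, rfl⟩ := h
  obtain ⟨x', y', m', n', hx', hy', e, rfl⟩ := h'
  obtain ⟨rfl, rfl⟩ := add_mul_omega_inj e
  rw [hx.unique hx', hy.unique hy']

theorem LatticeResidue.add {z w : ℂ} {j k : ZMod 5} (h : LatticeResidue z j)
    (h' : LatticeResidue w k) : LatticeResidue (z + w) (j + k) := by
  obtain ⟨x, y, m, n, hx, hy, rfl, rfl⟩ := h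
  obtain ⟨x', y', m', n', hx', hy', rfl, rfl⟩ := h'
  exact ⟨_, _, _, _, hx.add hx', hy.add hy', by push_cast; ring, by ring⟩

theorem LatticeResidue.neg {z : ℂ} {j : ZMod 5} (h : LatticeResidue z j) :
    LatticeResidue (-z) (-j) := by
  obtain ⟨x, y, m, n, hx, hy, rfl, rfl⟩ := h
  exact ⟨_, _, _, _, hx.neg, hy.neg, by push_cast; ring, by ring⟩

theorem LatticeResidue.smul {z : ℂ} {j m : ZMod 5} {r : ℝ} (h : LatticeResidue z j)
    (hr : Residue r m) : LatticeResidue (r * z) (m * j) := by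
  obtain ⟨x, y, m, n, hx, hy, rfl, rfl⟩ := h
  exact ⟨_, _, _, _, hr.mul hx, hr.mul hy, by push_cast; ring, by ring⟩

/-- By `omega_eq`, ω = -ζ³, which is -1 modulo 1 - ζ. -/
theorem LatticeResidue.omega_mul {z : ℂ} {j : ZMod 5} (h : LatticeResidue z j) :
    LatticeResidue (omega * z) (-j) := by
  obtain ⟨x, y, m, n, hx, hy, rfl, rfl⟩ := h
  refine ⟨_, _, _, _, hy.neg, hx.add (residue_gold.mul hy), ?_, ?_⟩
  · push_cast; linear_combination (y : ℂ) * omega_sq_eq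
  · have h5 : (5 : ZMod 5) = 0 := rfl
    linear_combination n * h5

theorem LatticeResidue.omega_pow_mul {z : ℂ} {j : ZMod 5} (h : LatticeResidue z j) (k : ℕ) :
    LatticeResidue (omega ^ k * z) ((-1) ^ k * j) := by
  induction k with
  | zero => simpa using h
  | succ k ih =>
    have := ih.omega_mul
    convert this using 1 <;> ring

theorem latticeResidue_one : LatticeResidue 1 1 :=
  ⟨1, 0, 1, 0, residue_one, residue_zero, by simp, by simp⟩

theorem latticeResidue_zero : LatticeResidue 0 0 :=
  ⟨0, 0, 0, 0, residue_zero, residue_zero, by simp, by simp⟩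

theorem latticeResidue_zeta_zpow (k : ℤ) : LatticeResidue (zeta ^ k) 1 := by
  induction k using Int.induction_on with
  | zero => simpa using latticeResidue_one
  | succ k ih =>
    rw [zpow_add_one₀ zeta_ne_zero, mul_comm]
    simpa [zeta] using ih.omega_pow_mul 2
  | pred k ih =>
    have : zeta ^ (-(k : ℤ) - 1) = omega ^ 8 * zeta ^ (-(k : ℤ)) := by
      rw [zpow_sub_one₀ zeta_ne_zero, mul_comm]
      congr 1
      refine inv_eq_of_mul_eq_one_left ?_
      have := zeta_pow_five
      rw [zeta] at this ⊢
      linear_combination this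
    rw [this]
    have h8 := ih.omega_pow_mul 8
    rwa [Even.neg_one_pow (by decide), one_mul] at h8

/-- The differences of the normals lie in the lattice, up to a scalar. -/
theorem latticeResidue_normal (k : ℤ) :
    ∃ y, -I * (zeta ^ k - 1) = 2 * sn * y ∧ LatticeResidue y (-k) := by
  -- Consecutive powers of ζ contribute `2 * sn` times ω ζ^k, each of residue -1; adding up k of
  -- them gives -k.
  have h1 : -I * (zeta - 1) = 2 * sn * omega := by
    have h : (2 * sn : ℂ) * I = omega - conj omega := by
      apply Complex.ext <;> simp [omega]; ring
    rw [zeta]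
    linear_combination (-I) * omega_mul_conj + I * omega * h - 2 * sn * omega * I_sq
  have step : ∀ k : ℤ, -I * (zeta ^ (k + 1) - 1) =
      -I * (zeta ^ k - 1) + 2 * sn * (omega * zeta ^ k) := by
    intro k
    rw [zpow_add_one₀ zeta_ne_zero]
    linear_combination zeta ^ k * h1
  induction k using Int.induction_on with
  | zero => exact ⟨0, by simp, by simpa using latticeResidue_zero⟩
  | succ k ih =>
    obtain ⟨y, e, hy⟩ := ih
    refine ⟨y + omega * zeta ^ (k : ℤ), ?_, ?_⟩
    · rw [step, e]; ring
    · convert hy.add (latticeResidue_zeta_zpow k).omega_mul using 1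
      push_cast; ring
  | pred k ih =>
    obtain ⟨y, e, hy⟩ := ih
    refine ⟨y + -(omega * zeta ^ (-(k : ℤ) - 1)), ?_, ?_⟩
    · have := step (-(k : ℤ) - 1)
      rw [sub_add_cancel, e] at this
      linear_combination -this
    · convert hy.add (latticeResidue_zeta_zpow (-(k : ℤ) - 1)).omega_mul.neg using 1
      push_cast; ring

/-! ### The graph and the reduction of the tree vectors -/

/-- The matrices `σ_k` modulo `√5`. -/
def sigmaResidue (k : Fin 4) (v : ZMod 5 × ZMod 5) : ZMod 5 × ZMod 5 :=
  ![(v.1 + 3 * v.2, v.2), (3 * v.1 + 3 * v.2, v.1 + 3 * v.2), (3 * v.1 + v.2, 3 * v.1 + 3 * v.2),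
    (v.1, 3 * v.1 + v.2)] k

/-- The tree vectors modulo `√5`. -/
def treeResidue (w : List (Fin 4)) : ZMod 5 × ZMod 5 :=
  w.foldl (fun v k => sigmaResidue k v) (1, 0)

theorem treeResidue_append (w : List (Fin 4)) (k : Fin 4) :
    treeResidue (w ++ [k]) = sigmaResidue k (treeResidue w) := by
  simp [treeResidue]

theorem residue_treeVector (w : List (Fin 4)) :
    Residue (treeVector w 0) (treeResidue w).1 ∧ Residue (treeVector w 1) (treeResidue w).2 := by
  induction w using List.reverseRecOn with
  | nil => exact ⟨residue_one, residue_zero⟩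
  | append_singleton w k ih =>
    rw [treeVector_append, treeResidue_append]
    obtain ⟨h0, h1⟩ := ih
    have gg : Real.goldenRatio = φ := rfl
    have hg := residue_gold
    fin_cases k <;>
      simp only [sigma, sigmaResidue, Matrix.mulVec, dotProduct, Fin.sum_univ_two, gg,
        Fin.zero_eta, Fin.mk_one, Fin.reduceFinMk, Matrix.cons_val_zero, Matrix.cons_val_one,
        Matrix.of_apply, Matrix.cons_val, one_mul, zero_mul, zero_add, add_zero]
    · exact ⟨h0.add (hg.mul h1), h1⟩
    · exact ⟨(hg.mul h0).add (hg.mul h1), h0.add (hg.mul h1)⟩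
    · exact ⟨(hg.mul h0).add h1, (hg.mul h0).add (hg.mul h1)⟩
    · exact ⟨h0, (hg.mul h0).add h1⟩

/-- The σ_k have determinant 1, so they stay invertible modulo √5. -/
theorem sigmaResidue_ne_zero : ∀ (k : Fin 4) (v : ZMod 5 × ZMod 5), v ≠ 0 →
    sigmaResidue k v ≠ 0 := by
  decide

theorem treeResidue_ne_zero (w : List (Fin 4)) : treeResidue w ≠ 0 := by
  induction w using List.reverseRecOn with
  | nil => decide
  | append_singleton w k ih => rw [treeResidue_append]; exact sigmaResidue_ne_zero k _ ih

/-- The functional modulo `√5` that belongs to a node. -/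
def nodeFunctional : Node → ZMod 5 × ZMod 5
  | .A => (1, -1)
  | .B => (1, 1)
  | .C => (1, 3)
  | .D => (1, 0)
  | .E => (1, 2)
  | .F => (0, 1)

/-- Up to a scalar, pulling the functional of X back along σ_k gives the functional at the start of
the arrow into X. Comparing zero sets makes the scalar irrelevant. -/
theorem nodeFunctional_arrow (k : Fin 4) (X : Node) : ∀ v : ZMod 5 × ZMod 5,
    (nodeFunctional ((arrow k).symm X)).1 * v.1 + (nodeFunctional ((arrow k).symm X)).2 * v.2 = 0 ↔
      (nodeFunctional X).1 * (sigmaResidue k v).1 +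
        (nodeFunctional X).2 * (sigmaResidue k v).2 = 0 := by
  fin_cases k <;> cases X <;> decide

theorem foldl_arrow_eq_F (l : List (Fin 4)) : ∀ X : Node,
    l.foldl (fun X k => (arrow k).symm X) X = .F ↔
      (nodeFunctional X).1 * (treeResidue l.reverse).1 +
        (nodeFunctional X).2 * (treeResidue l.reverse).2 = 0 := by
  induction l with
  -- At (1, 0) a functional takes its first coefficient as value, which is zero only for F.
  | nil => intro X; cases X <;> simp [treeResidue, nodeFunctional] <;> decide
  | cons k l ih =>
    intro X
    rw [List.foldl_cons, ih, List.reverse_cons, treeResidue_append]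
    exact nodeFunctional_arrow k X _

theorem endNode_eq_F_iff (w : List (Fin 4)) :
    endNode w = .F ↔ (treeResidue w).1 = (treeResidue w).2 := by
  rw [endNode, foldl_arrow_eq_F, List.reverse_reverse]
  simp [nodeFunctional, ← sub_eq_add_neg, sub_eq_zero]

theorem latticeResidue_pentagonVector (w : List (Fin 4)) :
    LatticeResidue (pentagonVector w) ((treeResidue w).1 - (treeResidue w).2) :=
  ⟨_, _, _, _, (residue_treeVector w).1, (residue_treeVector w).2, pentagonVector_eq w, rfl⟩

/-- An element of the lattice parallel to a tree vector has residue zero if the tree vector has. -/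
theorem LatticeResidue.eq_zero_of_parallel {z : ℂ} {j : ZMod 5} {r : ℝ} {w : List (Fin 4)}
    (h : LatticeResidue z j) (hz : z = r * pentagonVector w)
    (hw : (treeResidue w).1 = (treeResidue w).2) : j = 0 := by
  obtain ⟨x, y, m, n, hx, hy, rfl, rfl⟩ := h
  obtain ⟨h0, h1⟩ := residue_treeVector w
  rw [pentagonVector_eq] at hz
  obtain ⟨rfl, rfl⟩ := add_mul_omega_inj (x' := r * treeVector w 0) (y' := r * treeVector w 1)
    (by rw [hz]; push_cast; ring)
  -- The real factor r need not lie in ℤ[φ]; it drops out of the proportion between the coordinates,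
  -- which can then be reduced modulo √5.
  have h2 := hx.mul h1
  rw [mul_right_comm] at h2
  have h3 := h2.unique (hy.mul h0)
  rw [← hw] at h3
  have hne : (treeResidue w).1 ≠ 0 := by
    intro h
    exact treeResidue_ne_zero w (Prod.ext h (hw ▸ h))
  have : Fact (Nat.Prime 5) := ⟨by norm_num⟩
  rw [mul_right_cancel₀ hne h3, sub_self]

/-! ### Unfolding a trajectory to the double pentagon -/

/-- The symmetry `z ↦ ζ ^ k z` of the pentagon, or `z ↦ -ζ ^ k conj z` if `ε = -1`. -/
def symmetry (ε : ℝ) (k : ℤ) (z : ℂ) : ℂ := if ε = 1 then zeta ^ k * z else -zeta ^ k * conj z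

theorem zeta_zpow_mul_conj (k : ℤ) : zeta ^ k * conj (zeta ^ k) = 1 := by
  rw [map_zpow₀, ← mul_zpow, zeta_mul_conj, one_zpow]

theorem zeta_zpow_pow_five (k : ℤ) : (zeta ^ k) ^ 5 = 1 := by
  rw [← zpow_natCast, ← zpow_mul, mul_comm, zpow_mul, zpow_natCast, zeta_pow_five, one_zpow]

theorem conj_zeta_zpow (k : ℤ) : conj (zeta ^ k) = zeta ^ (-k) := by
  rw [zpow_neg]
  exact eq_inv_of_mul_eq_one_right (zeta_zpow_mul_conj k)

theorem symmetry_add_real_mul (ε : ℝ) (k : ℤ) (x y : ℂ) (t : ℝ) :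
    symmetry ε k (x + t * y) = symmetry ε k x + t * symmetry ε k y := by
  unfold symmetry
  split_ifs
  · ring
  · simp only [map_add, map_mul, conj_ofReal]; ring

theorem symmetry_neg (ε : ℝ) (k : ℤ) (x : ℂ) : symmetry ε k (-x) = -symmetry ε k x := by
  unfold symmetry
  split_ifs
  · ring
  · simp

theorem neg_I_conj (z : ℂ) : (-I) ^ 2 * conj z = -conj z := by
  linear_combination conj z * I_sq

theorem IsNormal.symmetry {μ : ℂ} (h : IsNormal μ) (ε : ℝ) (k : ℤ) :
    IsNormal (symmetry ε k μ) := by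
  unfold PentagonBilliard.symmetry
  split_ifs
  · exact h.root_mul (zeta_zpow_pow_five k)
  · have := (isNormal_neg_I.mirror h).root_mul (zeta_zpow_pow_five k)
    rwa [neg_I_conj, mul_neg, ← neg_mul] at this

theorem symmetry_mem_pentagon {z : ℂ} (h : z ∈ pentagon) (ε : ℝ) (k : ℤ) :
    symmetry ε k z ∈ pentagon := by
  unfold symmetry
  split_ifs
  · exact root_mul_mem_pentagon (zeta_zpow_pow_five k) h
  · have := root_mul_mem_pentagon (zeta_zpow_pow_five k) (mirror_mem_pentagon isNormal_neg_I h)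
    rwa [mirror, neg_I_conj, mul_neg, ← neg_mul] at this

theorem dot_symmetry (ε : ℝ) (k : ℤ) (z w : ℂ) :
    dot (symmetry ε k z) (symmetry ε k w) = dot z w := by
  unfold symmetry
  split_ifs
  · rw [dot_unit_mul (zeta_zpow_mul_conj k)]
  · rw [dot_unit_mul (by simpa using zeta_zpow_mul_conj k), dot_conj]

theorem symmetry_inverse (ε : ℝ) (k : ℤ) :
    ∃ l, (∀ z, symmetry ε l (symmetry ε k z) = z) ∧ ∀ z, symmetry ε k (symmetry ε l z) = z := by
  unfold symmetry
  have h := zeta_zpow_mul_conj k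
  split_ifs
  · refine ⟨-k, fun z => ?_, fun z => ?_⟩ <;> rw [← conj_zeta_zpow] <;> linear_combination z * h
  · refine ⟨k, fun z => ?_, fun z => ?_⟩ <;> simp only [map_mul, map_neg, conj_conj] <;>
      linear_combination z * h

theorem edgeNormal_eq_zpow {e : ℕ} : edgeNormal e = -I * zeta ^ ((e + 3 : ℕ) : ℤ) := by
  rw [zpow_natCast]; rfl

/-- A reflection of the pentagon composed with a symmetry. -/
theorem symmetry_mirror_one (k j : ℤ) (z : ℂ) :
    symmetry 1 k (mirror (-I * zeta ^ j) z) = symmetry (-1) (k + 2 * j) z := by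
  rw [symmetry, symmetry, if_pos rfl, if_neg (by norm_num), mirror, zpow_add₀ zeta_ne_zero,
    show 2 * j = j * (2 : ℕ) by push_cast; ring, zpow_mul, zpow_natCast]
  linear_combination (zeta ^ k * (zeta ^ j) ^ 2 * conj z) * I_sq

theorem symmetry_mirror_neg_one (k j : ℤ) (z : ℂ) :
    symmetry (-1) k (mirror (-I * zeta ^ j) z) = symmetry 1 (k - 2 * j) z := by
  rw [symmetry, symmetry, if_pos rfl, if_neg (by norm_num), mirror, sub_eq_add_neg,
    zpow_add₀ zeta_ne_zero, show -(2 * j) = -j * (2 : ℕ) by push_cast; ring, zpow_mul,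
    zpow_natCast, ← conj_zeta_zpow]
  simp only [map_mul, map_pow, map_neg, conj_I, conj_conj]
  linear_combination (-zeta ^ k * conj (zeta ^ j) ^ 2 * z) * I_sq

namespace Trajectory

variable (τ : Trajectory)

theorem exists_nrm_eq (n : ℤ) : ∃ j : ℤ, τ.nrm n = -I * zeta ^ j := ⟨_, edgeNormal_eq_zpow⟩

/-- The trajectory, started at the `n`-th bounce and unfolded to the double pentagon, enters at
the `m`-th bounce, at the time `t`, the copy `ε * pentagon` at the point that is the image of
`τ.pt m` under `symmetry ε k`. -/
inductive Lift (n : ℤ) : ℤ → ℝ → ℤ → ℝ → Prop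
  | base : Lift n n 1 0 0
  | next {m j k l : ℤ} {ε t : ℝ} : Lift n m ε k t → τ.nrm (m + 1) = -I * zeta ^ j →
      l = k + ε * 2 * j → Lift n (m + 1) (-ε) l (t + τ.len m)
  | prev {m j k l : ℤ} {ε t : ℝ} : Lift n m ε k t → τ.nrm m = -I * zeta ^ j →
      l = k + ε * 2 * j → Lift n (m - 1) (-ε) l (t - τ.len (m - 1))

variable {τ}

theorem Lift.sign {n m k : ℤ} {ε t : ℝ} (h : τ.Lift n m ε k t) :
    (ε = 1 ∧ Even (m - n)) ∨ (ε = -1 ∧ Odd (m - n)) := by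
  induction h with
  | base => simp
  | @next m _ _ _ _ _ _ _ _ ih =>
    rw [show m + 1 - n = m - n + 1 by ring]
    rcases ih with ⟨rfl, h⟩ | ⟨rfl, h⟩
    · right; exact ⟨rfl, h.add_one⟩
    · left; exact ⟨by norm_num, h.add_one⟩
  | @prev m _ _ _ _ _ _ _ _ ih =>
    rw [show m - 1 - n = m - n - 1 by ring]
    rcases ih with ⟨rfl, h⟩ | ⟨rfl, h⟩
    · right; exact ⟨rfl, h.sub_odd odd_one⟩
    · left; exact ⟨by norm_num, h.sub_odd odd_one⟩

/-- Crossing an edge composes the symmetry with a reflection of the pentagon. The index equation is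
stated in ℝ so that the sign ε can enter it as a factor. -/
theorem symmetry_flip {ε : ℝ} (hε : ε = 1 ∨ ε = -1) {k l j : ℤ} (hl : (l : ℝ) = k + ε * 2 * j)
    (z : ℂ) : symmetry ε k (mirror (-I * zeta ^ j) z) = symmetry (-ε) l z := by
  rcases hε with rfl | rfl
  · have : l = k + 2 * j := by
      have : (l : ℝ) = (k + 2 * j : ℤ) := by rw [hl]; push_cast; ring
      exact_mod_cast this
    rw [symmetry_mirror_one, this]
  · have : l = k - 2 * j := by
      have : (l : ℝ) = (k - 2 * j : ℤ) := by rw [hl]; push_cast; ring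
      exact_mod_cast this
    rw [symmetry_mirror_neg_one, this, neg_neg]

theorem Lift.sign_cases {n m k : ℤ} {ε t : ℝ} (h : τ.Lift n m ε k t) : ε = 1 ∨ ε = -1 := by
  rcases h.sign with h | h <;> tauto

theorem exists_flip {ε : ℝ} (hε : ε = 1 ∨ ε = -1) (k j : ℤ) :
    ∃ l : ℤ, (l : ℝ) = k + ε * 2 * j := by
  rcases hε with rfl | rfl
  · exact ⟨k + 2 * j, by push_cast; ring⟩
  · exact ⟨k - 2 * j, by push_cast; ring⟩

/-- The direction of an unfolded trajectory is constant. -/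
theorem Lift.dir {n m k : ℤ} {ε t : ℝ} (h : τ.Lift n m ε k t) :
    ε * symmetry ε k (τ.dir m) = τ.dir n := by
  induction h with
  | base => simp [symmetry]
  | @next m j k l ε t h hj hl ih =>
    rw [← symmetry_flip h.sign_cases hl, ← hj, τ.mirror_dir_succ, symmetry_neg, ← ih]
    push_cast; ring
  | @prev m j k l ε t h hj hl ih =>
    have e : τ.dir (m - 1) = -mirror (τ.nrm m) (τ.dir m) := by rw [τ.mirror_dir, neg_neg]
    rw [← symmetry_flip h.sign_cases hl, ← hj, e]
    have : mirror (τ.nrm m) (-mirror (τ.nrm m) (τ.dir m)) = -τ.dir m := by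
      conv_rhs => rw [← mirror_mirror (τ.isNormal_nrm m) (τ.dir m)]
      simp only [mirror, map_neg]; ring
    rw [this, symmetry_neg, ← ih]
    push_cast; ring

theorem Lift.next_pt {n m k l j : ℤ} {ε t : ℝ} (h : τ.Lift n m ε k t)
    (hj : τ.nrm (m + 1) = -I * zeta ^ j) (hl : (l : ℝ) = k + ε * 2 * j) :
    symmetry (-ε) l (τ.pt (m + 1)) = φ * symmetry ε k (τ.nrm (m + 1)) -
      symmetry ε k (τ.pt (m + 1)) := by
  rw [← symmetry_flip h.sign_cases hl, ← hj, ← edge_flip (τ.isNormal_nrm _) (τ.dot_pt _),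
    sub_eq_neg_add, symmetry_add_real_mul, symmetry_neg]
  ring

theorem Lift.prev_pt {n m k l j : ℤ} {ε t : ℝ} (h : τ.Lift n m ε k t)
    (hj : τ.nrm m = -I * zeta ^ j) (hl : (l : ℝ) = k + ε * 2 * j) :
    symmetry (-ε) l (τ.pt m) = φ * symmetry ε k (τ.nrm m) - symmetry ε k (τ.pt m) := by
  rw [← symmetry_flip h.sign_cases hl, ← hj, ← edge_flip (τ.isNormal_nrm _) (τ.dot_pt _),
    sub_eq_neg_add, symmetry_add_real_mul, symmetry_neg]
  ring

/-! ### Displacements of the unfolded copies and their residues -/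

/-- The translations by which the copies of the pentagon are displaced in the unfolding. -/
def Displacement (ε : ℝ) (k : ℤ) (d : ℂ) : Prop :=
  ∃ z, (ε = 1 ∧ LatticeResidue z (3 * k) ∧ d = 2 * sn * φ * z) ∨
    (ε = -1 ∧ LatticeResidue z (2 * k) ∧ d = -I * φ + 2 * sn * φ * z)

/-- From ε = 1 the crossing adds -(k + j) to the residue, and 3k - (k + j) ≡ 2(k + 2j). From ε = -1
it adds k - j, and 2k + (k - j) ≡ 3(k - 2j). This is where the coefficients 3 and 2 come from. -/
theorem Displacement.flip {ε : ℝ} {k l j : ℤ} {d : ℂ} (h : Displacement ε k d)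
    (hl : (l : ℝ) = k + ε * 2 * j) :
    Displacement (-ε) l (d + ε * φ * symmetry ε k (-I * zeta ^ j)) := by
  have h5 : (5 : ZMod 5) = 0 := rfl
  obtain ⟨z, ⟨rfl, hz, rfl⟩ | ⟨rfl, hz, rfl⟩⟩ := h
  · have : l = k + 2 * j := by
      have : (l : ℝ) = (k + 2 * j : ℤ) := by rw [hl]; push_cast; ring
      exact_mod_cast this
    subst this
    obtain ⟨y, e, hy⟩ := latticeResidue_normal (k + j)
    refine ⟨z + y, Or.inr ⟨rfl, ?_, ?_⟩⟩
    · convert hz.add hy using 1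
      push_cast
      linear_combination (j : ZMod 5) * h5
    · rw [zpow_add₀ zeta_ne_zero] at e
      rw [symmetry, if_pos rfl]
      push_cast
      linear_combination φ * e
  · have : l = k - 2 * j := by
      have : (l : ℝ) = (k - 2 * j : ℤ) := by rw [hl]; push_cast; ring
      exact_mod_cast this
    subst this
    obtain ⟨y, e, hy⟩ := latticeResidue_normal (k - j)
    refine ⟨z + -y, Or.inl ⟨by norm_num, ?_, ?_⟩⟩
    · convert hz.add hy.neg using 1
      push_cast
      linear_combination (-j : ZMod 5) * h5
    · rw [sub_eq_add_neg k, zpow_add₀ zeta_ne_zero, ← conj_zeta_zpow] at e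
      rw [symmetry, if_neg (by norm_num)]
      simp only [map_mul, map_neg, conj_I]
      push_cast
      linear_combination (-φ) * e

theorem Lift.displacement {n m k : ℤ} {ε t : ℝ} (h : τ.Lift n m ε k t) :
    ∃ d, Displacement ε k d ∧ τ.pt n + t * τ.dir n = ε * symmetry ε k (τ.pt m) + d := by
  induction h with
  | base =>
    exact ⟨0, ⟨0, Or.inl ⟨rfl, by simpa using latticeResidue_zero, by simp⟩⟩, by simp [symmetry]⟩
  | @next m j k l ε t h hj hl ih =>
    obtain ⟨d, hd, e⟩ := ih
    refine ⟨_, hd.flip hl, ?_⟩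
    have h1 := h.next_pt hj hl
    have h2 := h.dir
    have h3 : symmetry ε k (τ.pt (m + 1)) =
        symmetry ε k (τ.pt m) + τ.len m * symmetry ε k (τ.dir m) := by
      rw [τ.pt_succ, symmetry_add_real_mul]
    rw [h1, h3, ← hj]
    push_cast
    linear_combination e - (τ.len m : ℂ) * h2
  | @prev m j k l ε t h hj hl ih =>
    obtain ⟨d, hd, e⟩ := ih
    refine ⟨_, hd.flip hl, ?_⟩
    have h1 := h.prev_pt hj hl
    have h2 := (h.prev hj hl).dir
    have h3 : τ.pt m = τ.pt (m - 1) + τ.len (m - 1) * τ.dir (m - 1) := by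
      have := τ.pt_succ (m - 1)
      rwa [sub_add_cancel] at this
    have h4 : symmetry (-ε) l (τ.pt m) = symmetry (-ε) l (τ.pt (m - 1)) +
        τ.len (m - 1) * symmetry (-ε) l (τ.dir (m - 1)) := by
      conv_lhs => rw [h3]
      rw [symmetry_add_real_mul]
    rw [h4] at h1
    rw [← hj]
    push_cast at h2 ⊢
    linear_combination e + (ε : ℂ) * h1 + (τ.len (m - 1) : ℂ) * h2

variable (τ)

theorem exists_lift (n m : ℤ) : ∃ ε k t, τ.Lift n m ε k t := by
  have step : ∀ i : ℕ, (∃ ε k t, τ.Lift n (n + i) ε k t) ∧ ∃ ε k t, τ.Lift n (n - i) ε k t := by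
    intro i
    induction i with
    | zero => simpa using (⟨1, 0, 0, Lift.base⟩ : ∃ ε k t, τ.Lift n n ε k t)
    | succ i ih =>
      obtain ⟨⟨ε, k, t, h⟩, ⟨ε', k', t', h'⟩⟩ := ih
      push_cast
      rw [← add_assoc, ← sub_sub]
      constructor
      · obtain ⟨j, hj⟩ := τ.exists_nrm_eq (n + i + 1)
        obtain ⟨l, hl⟩ := exists_flip h.sign_cases k j
        exact ⟨_, _, _, h.next hj hl⟩
      · obtain ⟨j, hj⟩ := τ.exists_nrm_eq (n - i)
        obtain ⟨l, hl⟩ := exists_flip h'.sign_cases k' j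
        exact ⟨_, _, _, h'.prev hj hl⟩
  rcases le_total n m with h | h
  · obtain ⟨i, rfl⟩ := Int.le.dest h
    exact (step i).1
  · obtain ⟨i, rfl⟩ := Int.le.dest h
    simpa using (step i).2

/-- The unfolded trajectory, started at the `n`-th bounce, is at the time `t` at the point `p`. -/
def At (n : ℤ) (p : ℝ × ℂ) (t : ℝ) : Prop :=
  ∃ (m : ℤ) (ε : ℝ) (k : ℤ) (t₀ s : ℝ), τ.Lift n m ε k t₀ ∧ 0 ≤ s ∧ s ≤ τ.len m ∧
    p = (ε, symmetry ε k (τ.pt m + s * τ.dir m)) ∧ t = t₀ + s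

variable {τ}

theorem At.move {n : ℤ} {ε t₀ t : ℝ} {y : ℂ} (h : τ.At n (ε, y) t₀)
    (hy : y + ε * t * τ.dir n ∈ pentagon) : τ.At n (ε, y + ε * t * τ.dir n) (t₀ + t) := by
  obtain ⟨m, ε', k, t₁, s, hL, h0, h1, e, rfl⟩ := h
  obtain ⟨rfl, rfl⟩ := Prod.mk.inj e
  have hd := hL.dir
  have e1 : symmetry ε k (τ.pt m + s * τ.dir m) + ε * t * τ.dir n =
      symmetry ε k (τ.pt m + (s + t : ℝ) * τ.dir m) := by
    have : (ε : ℂ) * ε = 1 := by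
      rcases hL.sign_cases with h | h <;> rw [h] <;> norm_num
    rw [symmetry_add_real_mul, symmetry_add_real_mul, ← hd]
    push_cast
    linear_combination (t * symmetry ε k (τ.dir m)) * this
  rw [e1] at hy ⊢
  obtain ⟨l, hl, -⟩ := symmetry_inverse ε k
  have h2 := symmetry_mem_pentagon hy ε l
  rw [hl] at h2
  obtain ⟨h3, h4⟩ := τ.mem_chord h2
  exact ⟨m, ε, k, t₁, s + t, hL, h3, h4, rfl, by ring⟩

/-- The trajectory meets edges only at its bounces and never at a corner, so the gluing can only
lead to the adjacent segment, the next or the previous one. -/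
theorem At.glue {n : ℤ} {ε t : ℝ} {y μ : ℂ} (h : τ.At n (ε, y) t) (hμ : IsNormal μ)
    (hy : dot y μ = φ / 2) : τ.At n (-ε, φ * μ - y) t := by
  obtain ⟨m, ε', k, t₁, s, hL, h0, h1, e, rfl⟩ := h
  obtain ⟨rfl, rfl⟩ := Prod.mk.inj e
  obtain ⟨l, -, hl⟩ := symmetry_inverse ε k
  rw [← hl μ, dot_symmetry] at hy
  rcases τ.chord_edge h0 h1 (hμ.symmetry ε l) hy with ⟨rfl, h2⟩ | ⟨rfl, h2⟩
  · obtain ⟨j, hj⟩ := τ.exists_nrm_eq m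
    obtain ⟨k', hk'⟩ := exists_flip hL.sign_cases k j
    refine ⟨m - 1, -ε, k', _, τ.len (m - 1), hL.prev hj hk', (τ.len_pos _).le, le_rfl, ?_, ?_⟩
    · rw [← τ.pt_succ, sub_add_cancel, hL.prev_pt hj hk', ← h2, hl]
      simp
    · ring
  · obtain ⟨j, hj⟩ := τ.exists_nrm_eq (m + 1)
    obtain ⟨k', hk'⟩ := exists_flip hL.sign_cases k j
    refine ⟨m + 1, -ε, k', _, 0, hL.next hj hk', le_rfl, (τ.len_pos _).le, ?_, ?_⟩
    · rw [← τ.pt_succ, ofReal_zero, zero_mul, add_zero, hL.next_pt hj hk', ← h2, hl]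
    · ring

/-- A trajectory follows the leaves. -/
theorem At.iff_of_leaf {n : ℤ} {p q : ℝ × ℂ} {t : ℝ} (h : Leaf (τ.dir n) p q t) :
    ∀ t₀, τ.At n p t₀ ↔ τ.At n q (t₀ + t) := by
  induction h with
  | @move ε y t hv hz =>
    intro t₀
    refine ⟨fun h => h.move hz, fun h => ?_⟩
    have e : y + ε * t * τ.dir n + ε * (-t : ℝ) * τ.dir n = y := by push_cast; ring
    have := h.move (t := -t) (by rw [e]; exact hv.2)
    rwa [e, add_neg_cancel_right] at this
  | @glue ε y μ hv hμ hy =>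
    intro t₀
    rw [add_zero]
    refine ⟨fun h => h.glue hμ hy, fun h => ?_⟩
    have := h.glue hμ (by rw [dot_sub_left, dot_real_mul_left, hμ.dot_self, hy]; ring)
    rwa [neg_neg, sub_sub_cancel] at this
  | symm _ ih =>
    intro t₀
    rw [ih, add_assoc, neg_add_cancel, add_zero]
  | trans _ _ ih ih' =>
    intro t₀
    rw [ih, ih', add_assoc]

/-- If a leaf through the starting point closes up, then the trajectory comes back to its starting
point, rotated by a multiple of `2π/5` that can be read off from the length of the leaf. -/
theorem exists_return {n : ℤ} {t : ℝ} (h : Leaf (τ.dir n) (1, τ.pt n) (1, τ.pt n) t) :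
    ∃ (m k : ℤ) (z : ℂ), τ.pt n = zeta ^ k * τ.pt m ∧ τ.dir n = zeta ^ k * τ.dir m ∧
      LatticeResidue z (3 * k) ∧ t * τ.dir n = 2 * sn * φ * z := by
  have h0 : τ.At n (1, τ.pt n) 0 :=
    ⟨n, 1, 0, 0, 0, Lift.base, le_rfl, (τ.len_pos n).le, by simp [symmetry], by simp⟩
  obtain ⟨m, ε, k, t₀, s, hL, hs0, hs1, e, ht⟩ := (At.iff_of_leaf h 0).1 h0
  obtain ⟨rfl, e⟩ := Prod.mk.inj e
  have hd := hL.dir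
  obtain ⟨d, ⟨z, ⟨-, hz, rfl⟩ | ⟨h, -⟩⟩, hD⟩ := hL.displacement
  swap
  · norm_num at h
  rw [ofReal_one, one_mul] at hd hD
  -- The start of a segment cannot reappear as the end of one: the rotated or reflected chord
  -- continues for the length `τ.len n` inside the pentagon, so s < `τ.len m`, and the only edge
  -- point left is s = 0.
  have hs : s = 0 := by
    obtain ⟨l, hl, -⟩ := symmetry_inverse 1 k
    have h1 : τ.pt m + s * τ.dir m = symmetry 1 l (τ.pt n) := by rw [e, hl]
    have h2 : symmetry 1 l (τ.dir n) = τ.dir m := by rw [← hd, hl]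
    have h3 := symmetry_mem_pentagon (τ.pt_mem_pentagon (n + 1)) 1 l
    rw [τ.pt_succ, symmetry_add_real_mul, ← h1, h2] at h3
    have h4 : τ.pt m + (s + τ.len n : ℝ) * τ.dir m ∈ pentagon := by
      convert h3 using 1; push_cast; ring
    have h5 := (τ.mem_chord h4).2
    have h6 := τ.len_pos n
    have h7 : dot (τ.pt m + s * τ.dir m) (symmetry 1 l (τ.nrm n)) = φ / 2 := by
      rw [h1, dot_symmetry, τ.dot_pt]
    rcases τ.chord_edge hs0 hs1 ((τ.isNormal_nrm n).symmetry 1 l) h7 with h | h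
    · exact h.1
    · linarith [h.1]
  subst hs
  rw [ofReal_zero, zero_mul, add_zero] at e
  rw [zero_add, add_zero] at ht
  subst ht
  refine ⟨m, k, z, ?_, ?_, hz, ?_⟩
  · rw [e, symmetry, if_pos rfl]
  · rw [← hd, symmetry, if_pos rfl]
  · rw [← e] at hD
    linear_combination hD

/-- If a trajectory comes back rotated after an even number of bounces, then its displacement in
the double pentagon determines the rotation. -/
theorem return_displacement {n m : ℤ} (he : Even (m - n)) {a : ℂ}
    (hp : τ.pt m = a * τ.pt n) (hd : τ.dir m = a * τ.dir n) :
    ∃ (k : ℤ) (t : ℝ) (z : ℂ), zeta ^ k * a = 1 ∧ LatticeResidue z (3 * k) ∧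
      t * τ.dir n = 2 * sn * φ * z := by
  obtain ⟨ε, k, t, hL⟩ := τ.exists_lift n m
  rcases hL.sign with ⟨rfl, -⟩ | ⟨-, h⟩
  swap
  · exact absurd he (Int.not_even_iff_odd.2 h)
  have h1 := hL.dir
  obtain ⟨d, ⟨z, ⟨-, hz, rfl⟩ | ⟨h, -⟩⟩, hD⟩ := hL.displacement
  swap
  · norm_num at h
  have hne : τ.dir n ≠ 0 := by
    intro h
    have := τ.norm_dir n
    rw [h] at this
    simp at this
  rw [symmetry, if_pos rfl] at h1 hD
  have h2 : zeta ^ k * a = 1 := by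
    apply mul_right_cancel₀ hne
    rw [hd] at h1
    push_cast at h1
    linear_combination h1
  refine ⟨k, t, z, h2, hz, ?_⟩
  rw [hp] at hD
  push_cast at hD
  linear_combination hD + τ.pt n * h2

end Trajectory

/-! ### Rotations that preserve the picture of a trajectory -/

/-- A segment is uncountable, so one of countably many sets covering it contains two of its points.
This avoids knowing in advance that the picture consists of finitely many segments. -/
theorem exists_pair_of_segment_subset {x y : ℂ} {C : ℤ → Set ℂ}
    (h : segment ℝ x y ⊆ ⋃ m, C m) : ∃ m, ∃ s t : ℝ, s ≠ t ∧ x + s * (y - x) ∈ C m ∧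
      x + t * (y - x) ∈ C m := by
  by_contra! hC
  have hI : (Set.Icc (0 : ℝ) 1).Countable := by
    have : Set.Icc (0 : ℝ) 1 ⊆ ⋃ m, {s : ℝ | x + s * (y - x) ∈ C m} := by
      intro s hs
      have h1 : x + s * (y - x) ∈ segment ℝ x y := by
        rw [segment_eq_image']
        exact ⟨s, hs, by simp⟩
      obtain ⟨m, hm⟩ := Set.mem_iUnion.1 (h h1)
      exact Set.mem_iUnion.2 ⟨m, hm⟩
    refine (Set.countable_iUnion fun m => ?_).mono this
    refine Set.Subsingleton.countable ?_
    intro s hs t ht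
    by_contra hne
    exact hC m s t hne hs ht
  rw [← Cardinal.le_aleph0_iff_set_countable, Cardinal.mk_Icc_real zero_lt_one] at hI
  exact absurd hI (not_le.2 Cardinal.aleph0_lt_continuum)

namespace Trajectory

variable {τ : Trajectory}

theorem mem_segment_iff {n : ℤ} {z : ℂ} : z ∈ segment ℝ (τ.pt n) (τ.pt (n + 1)) ↔
    ∃ t : ℝ, 0 ≤ t ∧ t ≤ τ.len n ∧ z = τ.pt n + t * τ.dir n := by
  have hl := τ.len_pos n
  rw [segment_eq_image', τ.pt_succ]
  constructor
  · rintro ⟨s, ⟨h0, h1⟩, rfl⟩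
    exact ⟨s * τ.len n, by positivity, by nlinarith, by simp; ring⟩
  · rintro ⟨t, h0, h1, rfl⟩
    refine ⟨t / τ.len n, ⟨by positivity, by rwa [div_le_one hl]⟩, ?_⟩
    have : (τ.len n : ℂ) ≠ 0 := by exact_mod_cast hl.ne'
    simp
    field_simp

theorem path_subset : τ.path ⊆ pentagon := by
  intro z hz
  obtain ⟨n, hn⟩ := Set.mem_iUnion.1 hz
  rw [segment_eq_image'] at hn
  obtain ⟨s, ⟨h0, h1⟩, rfl⟩ := hn
  simpa using pentagon_convex (τ.pt_mem_pentagon n) (τ.pt_mem_pentagon (n + 1)) h0 h1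

/-- A motion of the plane that preserves the path takes each segment into a segment. -/
theorem segment_image {a b : ℂ} (ha : ‖a‖ = 1) (h : ∀ z ∈ τ.path, a * z + b ∈ τ.path) (n : ℤ) :
    ∃ (m : ℤ) (σ s : ℝ), (σ = 1 ∨ σ = -1) ∧ a * τ.dir n = σ * τ.dir m ∧
      a * τ.pt n + b = τ.pt m + s * τ.dir m ∧ 0 ≤ s ∧ s ≤ τ.len m ∧
      0 ≤ s + σ * τ.len n ∧ s + σ * τ.len n ≤ τ.len m := by
  have e1 : a * τ.pt (n + 1) + b - (a * τ.pt n + b) = a * (τ.len n * τ.dir n) := by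
    rw [τ.pt_succ]; ring
  have hsub : segment ℝ (a * τ.pt n + b) (a * τ.pt (n + 1) + b) ⊆
      ⋃ m, segment ℝ (τ.pt m) (τ.pt (m + 1)) := by
    intro z hz
    rw [segment_eq_image'] at hz
    obtain ⟨s, hs, rfl⟩ := hz
    have h1 : τ.pt n + s * (τ.pt (n + 1) - τ.pt n) ∈ τ.path := by
      refine Set.mem_iUnion.2 ⟨n, ?_⟩
      rw [segment_eq_image']
      exact ⟨s, hs, by simp⟩
    have h2 := h _ h1
    change _ ∈ τ.path
    convert h2 using 1
    simp only [real_smul]; ring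
  obtain ⟨m, s, t, hst, h1, h2⟩ := exists_pair_of_segment_subset hsub
  rw [mem_segment_iff, e1] at h1 h2
  obtain ⟨s', -, -, h1⟩ := h1
  obtain ⟨t', -, -, h2⟩ := h2
  -- Two common points make the unit directions parallel, hence equal up to sign.
  have hd : (((s - t) * τ.len n : ℝ) : ℂ) * (a * τ.dir n) = ((s' - t' : ℝ) : ℂ) * τ.dir m := by
    push_cast
    linear_combination h1 - h2
  have hne' : (s - t) * τ.len n ≠ 0 := mul_ne_zero (sub_ne_zero.2 hst) (τ.len_pos n).ne'
  have hnorm := congrArg norm hd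
  rw [norm_mul, norm_mul, norm_mul, norm_real, norm_real, ha, τ.norm_dir, τ.norm_dir, mul_one,
    mul_one, mul_one, Real.norm_eq_abs, Real.norm_eq_abs] at hnorm
  obtain ⟨σ, hσ, hd'⟩ : ∃ σ : ℝ, (σ = 1 ∨ σ = -1) ∧ a * τ.dir n = σ * τ.dir m := by
    have hc : (((s - t) * τ.len n : ℝ) : ℂ) ≠ 0 := by exact_mod_cast hne'
    rcases abs_eq_abs.1 hnorm with e | e
    · refine ⟨1, Or.inl rfl, mul_left_cancel₀ hc ?_⟩
      rw [hd, ← e]; push_cast; ring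
    · refine ⟨-1, Or.inr rfl, mul_left_cancel₀ hc ?_⟩
      rw [hd, e]; push_cast; ring
  have hp : a * τ.pt n + b = τ.pt m + (s' - s * τ.len n * σ : ℝ) * τ.dir m := by
    push_cast
    linear_combination h1 - s * τ.len n * hd'
  have hp1 : a * τ.pt (n + 1) + b =
      τ.pt m + (s' - s * τ.len n * σ + σ * τ.len n : ℝ) * τ.dir m := by
    push_cast at hp ⊢
    linear_combination hp + e1 + τ.len n * hd'
  have hmem : ∀ i, a * τ.pt i + b ∈ pentagon := by
    intro i
    refine path_subset (h _ (Set.mem_iUnion.2 ⟨i, left_mem_segment ℝ _ _⟩))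
  have h3 := hmem n
  have h4 := hmem (n + 1)
  rw [hp] at h3
  rw [hp1] at h4
  exact ⟨m, σ, _, hσ, hd', hp, (τ.mem_chord h3).1, (τ.mem_chord h3).2, (τ.mem_chord h4).1,
    (τ.mem_chord h4).2⟩

/-- A motion of the plane that preserves the path permutes its segments. -/
theorem segment_perm {a b a' b' : ℂ} (ha : ‖a‖ = 1) (h : ∀ z ∈ τ.path, a * z + b ∈ τ.path)
    (h' : ∀ z ∈ τ.path, a' * z + b' ∈ τ.path) (ha' : ‖a'‖ = 1)
    (hinv : ∀ z, a' * (a * z + b) + b' = z) (n : ℤ) :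
    ∃ m, (a * τ.pt n + b = τ.pt m ∧ a * τ.pt (n + 1) + b = τ.pt (m + 1) ∧
        a * τ.dir n = τ.dir m) ∨
      (a * τ.pt n + b = τ.pt (m + 1) ∧ a * τ.pt (n + 1) + b = τ.pt m ∧
        a * τ.dir n = -τ.dir m) := by
  obtain ⟨m, σ, s, hσ, hd, hp, h0, h1, h2, h3⟩ := segment_image ha h n
  obtain ⟨l, σ', s', hσ', hd', hp', h0', h1', h2', h3'⟩ := segment_image ha' h' m
  have haa : a' * a = 1 := by
    have e0 := hinv 0
    have e1 := hinv 1
    linear_combination e1 - e0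
  have hlen : τ.len m ≤ τ.len l := by
    rcases hσ' with rfl | rfl <;> linarith
  have e0 : τ.pt n = τ.pt l + (s' + s * σ' : ℝ) * τ.dir l := by
    have := hinv (τ.pt n)
    rw [hp] at this
    push_cast
    linear_combination hp' - this + s * hd'
  have e1 : τ.dir n = (σ * σ' : ℝ) * τ.dir l := by
    push_cast
    linear_combination a' * hd - τ.dir n * haa + σ * hd'
  have e2 : τ.pt (n + 1) = τ.pt l + (s' + s * σ' + τ.len n * (σ * σ') : ℝ) * τ.dir l := by
    rw [τ.pt_succ]
    push_cast at e0 e1 ⊢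
    linear_combination e0 + τ.len n * e1
  have hn := τ.pt_mem_pentagon n
  have hn1 := τ.pt_mem_pentagon (n + 1)
  have d0 := τ.dot_pt n
  have d1 := τ.dot_pt (n + 1)
  rw [e0] at hn d0
  rw [e2] at hn1 d1
  have c0 := τ.chord_edge (τ.mem_chord hn).1 (τ.mem_chord hn).2 (τ.isNormal_nrm n) d0
  have c1 := τ.chord_edge (τ.mem_chord hn1).1 (τ.mem_chord hn1).2 (τ.isNormal_nrm (n + 1)) d1
  have hpos := τ.len_pos n
  have hll := τ.len_pos l
  -- The n-th segment lies in the m-th one up to motion, and this in the l-th. Both ends of the n-th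
  -- lie on edges, so it is all of the l-th, and the three lengths agree.
  have hle : τ.len m ≤ τ.len n := by
    rcases hσ with rfl | rfl <;> rcases hσ' with rfl | rfl <;> rcases c0 with ⟨c0, -⟩ | ⟨c0, -⟩ <;>
      rcases c1 with ⟨c1, -⟩ | ⟨c1, -⟩ <;> linarith
  refine ⟨m, ?_⟩
  rcases hσ with rfl | rfl
  · left
    obtain rfl : s = 0 := by linarith
    have hlm : τ.len m = τ.len n := by linarith
    rw [τ.pt_succ n, τ.pt_succ m, hlm]
    push_cast at hp hd
    exact ⟨by rw [hp]; simp, by linear_combination hp + τ.len n * hd, by rw [hd]; simp⟩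
  · right
    obtain rfl : s = τ.len m := by linarith
    have hlm : τ.len m = τ.len n := by linarith
    rw [← τ.pt_succ] at hp
    refine ⟨hp, ?_, by rw [hd]; simp⟩
    rw [τ.pt_succ] at hp ⊢
    rw [hlm] at hp
    push_cast at hd
    linear_combination hp + τ.len n * hd

/-! ### Directions at a bounce and the recovery of the normals -/

/-- The directions in which the segments that end at the point `p` leave it. -/
def germs (τ : Trajectory) (p : ℂ) : Set ℂ :=
  {d | ∃ m, (τ.pt m = p ∧ d = τ.dir m) ∨ (τ.pt (m + 1) = p ∧ d = -τ.dir m)}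

/-- A reflection sends d to -μ² conj d, and (μ²)¹⁰ = 1, so each bounce conjugates the tenth power.
Hence only finitely many directions occur, and those at a point can be summed. -/
theorem dir_pow_ten (n : ℤ) :
    τ.dir n ^ 10 = τ.dir 0 ^ 10 ∨ τ.dir n ^ 10 = conj (τ.dir 0 ^ 10) := by
  have step : ∀ n, τ.dir (n + 1) ^ 10 = conj (τ.dir n ^ 10) := by
    intro n
    have hμ : (τ.nrm (n + 1) ^ 2) ^ 10 = 1 := by
      have h := τ.isNormal_nrm (n + 1)
      unfold IsNormal at h
      rw [← pow_mul, show 2 * 10 = 5 * 4 by norm_num, pow_mul, h]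
      linear_combination (I ^ 2 - 1) * I_sq
    rw [τ.dir_succ, Even.neg_pow (by decide), mirror, mul_pow, hμ, one_mul, map_pow]
  induction n using Int.induction_on with
  | zero => simp
  | succ n ih =>
    rw [step]
    rcases ih with h | h <;> rw [h]
    · simp
    · simp
  | pred n ih =>
    have := step (-(n : ℤ) - 1)
    rw [sub_add_cancel] at this
    rw [← conj_conj (τ.dir (-(n : ℤ) - 1) ^ 10), ← this]
    rcases ih with h | h <;> rw [h]
    · simp
    · simp

theorem finite_germs (p : ℂ) : (τ.germs p).Finite := by
  have hroots : ∀ c : ℂ, {z : ℂ | z ^ 10 = c}.Finite := by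
    intro c
    refine (Polynomial.nthRoots 10 c).toFinset.finite_toSet.subset fun z hz => ?_
    simpa [Polynomial.mem_nthRoots] using hz
  refine ((hroots (τ.dir 0 ^ 10)).union (hroots (conj (τ.dir 0 ^ 10)))).subset ?_
  rintro d ⟨m, ⟨-, rfl⟩ | ⟨-, rfl⟩⟩
  · exact dir_pow_ten m
  · simpa [Even.neg_pow (show Even 10 by decide)] using dir_pow_ten (τ := τ) m

theorem nrm_eq_of_pt_eq {m n : ℤ} (h : τ.pt m = τ.pt n) : τ.nrm m = τ.nrm n := by
  simpa using nrm_of_pt (τ := τ) (τ' := τ) (a := 1) (by norm_num) (by simpa using h)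

theorem mirror_mem_germs {n : ℤ} {d : ℂ} (h : d ∈ τ.germs (τ.pt n)) :
    mirror (τ.nrm n) d ∈ τ.germs (τ.pt n) := by
  obtain ⟨m, ⟨hm, rfl⟩ | ⟨hm, rfl⟩⟩ := h
  · refine ⟨m - 1, Or.inr ⟨by rwa [sub_add_cancel], ?_⟩⟩
    rw [← nrm_eq_of_pt_eq hm, mirror_dir]
  · refine ⟨m + 1, Or.inl ⟨hm, ?_⟩⟩
    rw [← nrm_eq_of_pt_eq hm, dir_succ]
    simp [mirror]

theorem dot_germs {n : ℤ} {d : ℂ} (h : d ∈ τ.germs (τ.pt n)) : dot d (τ.nrm n) < 0 := by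
  obtain ⟨m, ⟨hm, rfl⟩ | ⟨hm, rfl⟩⟩ := h
  · rw [← nrm_eq_of_pt_eq hm]
    exact τ.dot_dir_nrm m
  · rw [← nrm_eq_of_pt_eq hm]
    have := τ.dot_dir_nrm_succ m
    simp only [dot, neg_re, neg_im] at *
    linarith

/-- The sum of the germs at a bounce is a negative multiple of the normal. -/
theorem sum_germs (n : ℤ) : ∃ r : ℝ, r < 0 ∧
    ∑ d ∈ (finite_germs (τ := τ) (τ.pt n)).toFinset, d = r * τ.nrm n := by
  set F := (finite_germs (τ := τ) (τ.pt n)).toFinset with hF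
  have hμ := τ.isNormal_nrm n
  have hmem : ∀ d, d ∈ F ↔ d ∈ τ.germs (τ.pt n) := fun d => by simp [hF]
  -- The mirror is an involution of the germs, so their sum lies on its axis, the line spanned by
  -- the normal.
  have hsum : ∑ d ∈ F, d = ∑ d ∈ F, mirror (τ.nrm n) d := by
    refine Finset.sum_bij' (fun d _ => mirror (τ.nrm n) d) (fun d _ => mirror (τ.nrm n) d) ?_ ?_
      ?_ ?_ ?_
    · intro d hd; rw [hmem] at *; exact mirror_mem_germs hd
    · intro d hd; rw [hmem] at *; exact mirror_mem_germs hd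
    · intro d _; exact mirror_mirror hμ d
    · intro d _; exact mirror_mirror hμ d
    · intro d _; exact (mirror_mirror hμ d).symm
  have hm : mirror (τ.nrm n) (∑ d ∈ F, d) = ∑ d ∈ F, d := by
    conv_rhs => rw [hsum]
    simp [mirror, Finset.mul_sum]
  have hdot : dot (∑ d ∈ F, d) (τ.nrm n) = ∑ d ∈ F, dot d (τ.nrm n) := by
    simp only [dot, re_sum, im_sum, Finset.sum_mul, Finset.sum_add_distrib]
  refine ⟨dot (∑ d ∈ F, d) (τ.nrm n), ?_, ?_⟩
  · rw [hdot]
    refine Finset.sum_neg (fun d hd => dot_germs ((hmem d).1 hd)) ?_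
    exact ⟨τ.dir n, (hmem _).2 ⟨n, Or.inl ⟨rfl, rfl⟩⟩⟩
  · rw [mirror_eq hμ] at hm
    push_cast at hm
    linear_combination (-1 / 2) * hm

theorem germs_image {a b a' b' : ℂ} (ha : ‖a‖ = 1) (h : ∀ z ∈ τ.path, a * z + b ∈ τ.path)
    (h' : ∀ z ∈ τ.path, a' * z + b' ∈ τ.path) (ha' : ‖a'‖ = 1)
    (hinv : ∀ z, a' * (a * z + b) + b' = z) {p d : ℂ} (hd : d ∈ τ.germs p) :
    a * d ∈ τ.germs (a * p + b) := by
  obtain ⟨n, hn⟩ := hd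
  obtain ⟨m, ⟨e0, e1, e2⟩ | ⟨e0, e1, e2⟩⟩ := segment_perm ha h h' ha' hinv n <;>
    rcases hn with ⟨rfl, rfl⟩ | ⟨rfl, rfl⟩
  · exact ⟨m, Or.inl ⟨e0.symm, e2⟩⟩
  · exact ⟨m, Or.inr ⟨e1.symm, by rw [mul_neg, e2]⟩⟩
  · exact ⟨m, Or.inr ⟨e0.symm, e2⟩⟩
  · exact ⟨m, Or.inl ⟨e1.symm, by rw [mul_neg, e2, neg_neg]⟩⟩

/-- A motion of the plane that preserves the path takes normals to normals. -/
theorem exists_pt_and_nrm_image {a b a' b' : ℂ} (ha : ‖a‖ = 1)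
    (h : ∀ z ∈ τ.path, a * z + b ∈ τ.path) (h' : ∀ z ∈ τ.path, a' * z + b' ∈ τ.path)
    (ha' : ‖a'‖ = 1) (hinv : ∀ z, a' * (a * z + b) + b' = z)
    (hinv' : ∀ z, a * (a' * z + b') + b = z) (n : ℤ) :
    ∃ m, a * τ.pt n + b = τ.pt m ∧ a * τ.nrm n = τ.nrm m := by
  obtain ⟨m, e⟩ : ∃ m, a * τ.pt n + b = τ.pt m := by
    obtain ⟨m, ⟨e, -⟩ | ⟨e, -⟩⟩ := segment_perm ha h h' ha' hinv n
    · exact ⟨m, e⟩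
    · exact ⟨m + 1, e⟩
  refine ⟨m, e, ?_⟩
  have haa : a * a' = 1 := by
    have e0 := hinv' 0
    have e1 := hinv' 1
    linear_combination e1 - e0
  have e' : a' * τ.pt m + b' = τ.pt n := by rw [← e, hinv]
  obtain ⟨r, hr, hs⟩ := sum_germs (τ := τ) n
  obtain ⟨r', hr', hs'⟩ := sum_germs (τ := τ) m
  have hsum : a * ∑ d ∈ (finite_germs (τ := τ) (τ.pt n)).toFinset, d =
      ∑ d ∈ (finite_germs (τ := τ) (τ.pt m)).toFinset, d := by
    rw [Finset.mul_sum]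
    refine Finset.sum_bij' (fun d _ => a * d) (fun d _ => a' * d) ?_ ?_ ?_ ?_ ?_
    · intro d hd
      rw [Set.Finite.mem_toFinset] at *
      rw [← e]
      exact germs_image ha h h' ha' hinv hd
    · intro d hd
      rw [Set.Finite.mem_toFinset] at *
      rw [← e']
      exact germs_image ha' h' h ha hinv' hd
    · intro d _; linear_combination d * haa
    · intro d _; linear_combination d * haa
    · intro d _; rfl
  rw [hs, hs'] at hsum
  have norm_one : ∀ k, ‖τ.nrm k‖ = 1 := by
    intro k
    have h5 := congrArg norm (τ.isNormal_nrm k)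
    rw [norm_pow, norm_neg, norm_I] at h5
    exact (pow_eq_one_iff_of_nonneg (norm_nonneg _) (by norm_num)).1 h5
  have hn := congrArg norm hsum
  rw [norm_mul, norm_mul, norm_mul, ha, norm_one, norm_one, norm_real, norm_real,
    Real.norm_eq_abs, Real.norm_eq_abs, abs_of_neg hr, abs_of_neg hr'] at hn
  have hrr : r = r' := by linarith
  have hr0 : (r : ℂ) ≠ 0 := by exact_mod_cast hr.ne
  rw [← hrr] at hsum
  apply mul_left_cancel₀ hr0
  linear_combination hsum

/-- Distinct normals are linearly independent: dependent unit vectors would be opposite, but the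
fifth powers of opposite vectors differ in sign. -/
theorem eq_zero_of_dot_normals {t ν ν' : ℂ} (h : IsNormal ν) (h' : IsNormal ν') (hne : ν ≠ ν')
    (ht : dot t ν = 0) (ht' : dot t ν' = 0) : t = 0 := by
  have h1 := h.dot_self
  have h1' := h'.dot_self
  by_cases hdet : ν.re * ν'.im - ν.im * ν'.re = 0
  · exfalso
    have e : ν' = (dot ν ν' : ℝ) * ν := by
      simp only [dot] at *
      apply Complex.ext <;> simp
      · linear_combination (-ν'.re) * h1 - ν.im * hdet
      · linear_combination (-ν'.im) * h1 + ν.re * hdet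
    have hsq : dot ν ν' * dot ν ν' = 1 := by
      simp only [dot] at *
      linear_combination (ν'.re * ν'.re + ν'.im * ν'.im) * h1 + h1' -
        (ν.re * ν'.im - ν.im * ν'.re) * hdet
    rcases mul_self_eq_one_iff.1 hsq with hq | hq
    · rw [hq] at e
      exact hne (by simpa using e.symm)
    · rw [hq] at e
      unfold IsNormal at h h'
      rw [e] at h'
      push_cast at h'
      rw [mul_pow, h] at h'
      have := congrArg Complex.im h'
      norm_num at this
  · simp only [dot] at *
    apply Complex.ext
    · apply mul_left_cancel₀ hdet
      simp only [zero_re]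
      linear_combination ν'.im * ht - ν.im * ht'
    · apply mul_left_cancel₀ hdet
      simp only [zero_im]
      linear_combination (-ν'.re) * ht + ν.re * ht'

/-- A rotation that preserves the path of a trajectory is a rotation of the pentagon; it takes the
trajectory to a rotated trajectory that moves along the given one, forwards or backwards. -/
theorem rotation_of_image_eq {c : ℂ} {a : Circle} (h : rotateAbout c a '' τ.path = τ.path) :
    (a : ℂ) ^ 5 = 1 ∧ (a ≠ 1 → ∀ n, ∃ m,
      (τ.pt m = a * τ.pt n ∧ τ.dir m = a * τ.dir n) ∨
      (τ.pt (m + 1) = a * τ.pt n ∧ -τ.dir m = a * τ.dir n)) := by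
  have hn : ‖(a : ℂ)‖ = 1 := Circle.norm_coe a
  have hn' : ‖(a : ℂ)⁻¹‖ = 1 := by rw [norm_inv, hn, inv_one]
  have ha0 : (a : ℂ) ≠ 0 := Circle.coe_ne_zero a
  set b : ℂ := c - a * c with hb
  have hrot : ∀ z, rotateAbout c a z = a * z + b := by
    intro z; rw [rotateAbout, hb]; ring
  have hinv : ∀ z, (a : ℂ)⁻¹ * (a * z + b) + -((a : ℂ)⁻¹ * b) = z := by
    intro z; field_simp; ring
  have hinv' : ∀ z, a * ((a : ℂ)⁻¹ * z + -((a : ℂ)⁻¹ * b)) + b = z := by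
    intro z; field_simp; ring
  have h1 : ∀ z ∈ τ.path, a * z + b ∈ τ.path := by
    intro z hz
    rw [← hrot, ← h]
    exact ⟨z, hz, rfl⟩
  have h2 : ∀ z ∈ τ.path, (a : ℂ)⁻¹ * z + -((a : ℂ)⁻¹ * b) ∈ τ.path := by
    intro z hz
    rw [← h] at hz
    obtain ⟨w, hw, rfl⟩ := hz
    rwa [hrot, hinv]
  have himg := exists_pt_and_nrm_image hn h1 h2 hn' hinv hinv'
  have h5 : (a : ℂ) ^ 5 = 1 := by
    obtain ⟨m, -, e⟩ := himg 0
    have e5 := congrArg (· ^ 5) e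
    have k0 := τ.isNormal_nrm 0
    have km := τ.isNormal_nrm m
    unfold IsNormal at k0 km
    simp only [mul_pow, k0, km] at e5
    exact mul_right_cancel₀ (neg_ne_zero.2 I_ne_zero) (e5.trans (one_mul _).symm)
  refine ⟨h5, fun ha1 n => ?_⟩
  have hc : (a : ℂ) * conj (a : ℂ) = 1 := mul_conj_of_pow_eq (by norm_num) h5 (by simp)
  -- Edges go to edges at the same distance φ/2 from the centre, so the translation part is
  -- orthogonal to every rotated normal that occurs, and two of these are different.
  have hb0 : b = 0 := by
    have hdot : ∀ k, dot b (a * τ.nrm k) = 0 := by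
      intro k
      obtain ⟨m, e1, e2⟩ := himg k
      have h3 := τ.dot_pt m
      rw [← e1, ← e2, dot_add_left, dot_unit_mul hc, τ.dot_pt] at h3
      linarith
    refine eq_zero_of_dot_normals ((τ.isNormal_nrm 0).root_mul h5)
      ((τ.isNormal_nrm (0 + 1)).root_mul h5) ?_ (hdot _) (hdot _)
    intro e
    exact τ.nrm_succ_ne 0 (mul_left_cancel₀ ha0 e).symm
  obtain ⟨m, ⟨e0, -, e2⟩ | ⟨e0, -, e2⟩⟩ := segment_perm hn h1 h2 hn' hinv n
  · exact ⟨m, Or.inl ⟨by rw [← e0, hb0, add_zero], e2.symm⟩⟩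
  · exact ⟨m, Or.inr ⟨by rw [← e0, hb0, add_zero], e2.symm⟩⟩

end Trajectory

/-! ### The symmetry of the pictures -/

theorem Leaf.scale {u : ℂ} {p q : ℝ × ℂ} {t r : ℝ} (hr : r ≠ 0) (h : Leaf u p q t) :
    Leaf (r * u) p q (t / r) := by
  have hr' : (r : ℂ) ≠ 0 := by exact_mod_cast hr
  induction h with
  | @move ε y t h h' =>
    have e : y + ε * t * u = y + ε * (t / r : ℝ) * (r * u) := by
      push_cast; field_simp
    rw [e] at h' ⊢
    exact Leaf.move h h'
  | glue h hμ he => rw [zero_div]; exact Leaf.glue h hμ he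
  | symm _ ih => rw [neg_div]; exact ih.symm
  | trans _ _ ih ih' => rw [add_div]; exact ih.trans ih'

theorem zeta_zpow_eq_one_iff (k : ℤ) : zeta ^ k = 1 ↔ (k : ZMod 5) = 0 := by
  rw [(IsPrimitiveRoot.iff_orderOf.2 orderOf_zeta).zpow_eq_one_iff_dvd,
    ← ZMod.intCast_zmod_eq_zero_iff_dvd]

namespace Trajectory

variable {τ : Trajectory}

theorem dir_determined {a : ℂ} (ha : a ^ 5 = 1) {m n : ℤ}
    (hp : τ.pt m = a * τ.pt n) (hd : τ.dir m = a * τ.dir n) (i : ℤ) :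
    τ.dir (m + i) = a * τ.dir (n + i) := by
  have hn : ‖a‖ = 1 := by
    have h5 := congrArg norm ha
    rw [norm_pow, norm_one] at h5
    exact (pow_eq_one_iff_of_nonneg (norm_nonneg _) (by norm_num)).1 h5
  have h0 := determined ha hp hd i
  have h1 := determined ha hp hd (i + 1)
  rw [dir, dir, unitDirection, unitDirection, add_assoc, add_assoc, h0, h1, ← mul_sub, norm_mul, hn,
    one_mul, mul_div_assoc]

theorem HasTreeWord.dir_eq {w : List (Fin 4)} (h : τ.HasTreeWord w) :
    ∃ (n : ℤ) (k : ℕ) (r : ℝ), r ≠ 0 ∧ τ.dir n = r * (omega ^ k * pentagonVector w) := by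
  obtain ⟨n, k, r, hr, e⟩ := h
  have hl := τ.len_pos n
  refine ⟨n, k, r / τ.len n, by positivity, ?_⟩
  rw [dir, unitDirection, ← len, e, exp_eq_omega]
  push_cast
  ring

theorem path_rotate {a : ℂ} (ha : a ^ 5 = 1) {m n : ℤ} (hp : τ.pt m = a * τ.pt n)
    (hd : τ.dir m = a * τ.dir n) : (fun z => a * z) '' τ.path = τ.path := by
  have hseg : ∀ i, (fun z => a * z) '' segment ℝ (τ.pt i) (τ.pt (i + 1)) =
      segment ℝ (a * τ.pt i) (a * τ.pt (i + 1)) := fun i =>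
    image_segment ℝ (LinearMap.mulLeft ℝ a).toAffineMap (τ.pt i) (τ.pt (i + 1))
  have hdet := determined ha hp hd
  rw [path, Set.image_iUnion]
  simp only [hseg]
  have e : ∀ i, segment ℝ (a * τ.pt i) (a * τ.pt (i + 1)) =
      segment ℝ (τ.pt (i + (m - n))) (τ.pt (i + (m - n) + 1)) := by
    intro i
    have h0 := hdet (i - n)
    have h1 := hdet (i + 1 - n)
    rw [show m + (i - n) = i + (m - n) by ring, show n + (i - n) = i by ring] at h0
    rw [show m + (i + 1 - n) = i + (m - n) + 1 by ring, show n + (i + 1 - n) = i + 1 by ring] at h1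
    rw [h0, h1]
  simp only [e]
  exact (Equiv.addRight (m - n)).iSup_comp
    (g := fun i => segment ℝ (τ.pt i) (τ.pt (i + 1)))

/-- If the tree word does not lead to `F`, then the trajectory comes back rotated. -/
theorem exists_rotated_return {w : List (Fin 4)} (h : τ.HasTreeWord w)
    (hF : (treeResidue w).1 ≠ (treeResidue w).2) :
    ∃ (m n k : ℤ), (k : ZMod 5) ≠ 0 ∧ τ.pt n = zeta ^ k * τ.pt m ∧
      τ.dir n = zeta ^ k * τ.dir m := by
  obtain ⟨n, k, r, hr, hdir⟩ := h.dir_eq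
  set u := omega ^ k * pentagonVector w with hu
  obtain ⟨i, hi⟩ := (closes_pentagonVector w).rotate_pow k (1, τ.pt n)
    ⟨Or.inl rfl, τ.pt_mem_pentagon n⟩
  have hL := hi.scale hr
  rw [← hu, ← hdir] at hL
  obtain ⟨m, l, z, h1, h2, hz, e⟩ := exists_return hL
  refine ⟨m, n, l, ?_, h1, h2⟩
  have hr' : (r : ℂ) ≠ 0 := by exact_mod_cast hr
  have hs : (2 * sn * φ : ℂ) ≠ 0 := by
    have := sn_ne; have := gold_pos.ne'
    exact_mod_cast (by positivity : 2 * sn * φ ≠ 0)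
  -- Since `circ false` = 2 sn φ and `circ true` = 2 sn φ², z is u or φu, and both have nonzero
  -- residue.
  have e' : (circ i : ℂ) * u = 2 * sn * φ * z := by
    rw [← e, hdir]
    push_cast
    field_simp
  have hru := (latticeResidue_pentagonVector w).omega_pow_mul k
  rw [← hu] at hru
  have d1 : (-1 : ZMod 5) ≠ 0 := by decide
  have d3 : (3 : ZMod 5) ≠ 0 := by decide
  have hp : Fact (Nat.Prime 5) := ⟨by norm_num⟩
  have hne : ((-1) ^ k * ((treeResidue w).1 - (treeResidue w).2) : ZMod 5) ≠ 0 :=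
    mul_ne_zero (pow_ne_zero _ d1) (sub_ne_zero.2 hF)
  intro hl
  rw [hl, mul_zero] at hz
  cases i
  · have : z = u := by
      apply mul_left_cancel₀ hs
      rw [← e']; simp only [circ, cond]; push_cast; ring
    rw [this] at hz
    exact hne (hru.unique hz)
  · have : z = φ * u := by
      apply mul_left_cancel₀ hs
      rw [← e']; simp only [circ, cond]; push_cast
      linear_combination (-(2 * sn * u)) * gold_sq_complex
    rw [this] at hz
    exact mul_ne_zero d3 hne ((hru.smul residue_gold).unique hz)

theorem hasRotationalSymmetryOfOrder_five {w : List (Fin 4)} (h : τ.HasTreeWord w)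
    (hF : (treeResidue w).1 ≠ (treeResidue w).2) :
    HasRotationalSymmetryOfOrder 5 0 τ.path := by
  intro a
  constructor
  · intro h
    exact Circle.ext (by simpa using (rotation_of_image_eq h).1)
  · intro ha
    have ha' : (a : ℂ) ^ 5 = 1 := by rw [← Circle.coe_pow, ha, Circle.coe_one]
    obtain ⟨m, n, k, hk, h1, h2⟩ := exists_rotated_return h hF
    set b := zeta ^ k with hb
    have hb5 : b ^ 5 = 1 := zeta_zpow_pow_five k
    have hb1 : b ≠ 1 := by rwa [hb, Ne, zeta_zpow_eq_one_iff]
    have hprime : Nat.Prime 5 := by norm_num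
    have : Fact (Nat.Prime 5) := ⟨hprime⟩
    -- As 5 is prime, the single nontrivial rotation b generates all the others.
    have hprim : IsPrimitiveRoot b 5 := IsPrimitiveRoot.iff_orderOf.2 (orderOf_eq_prime hb5 hb1)
    obtain ⟨i, -, hi⟩ := hprim.eq_pow_of_pow_eq_one ha'
    have hrot : rotateAbout 0 a = fun z => (a : ℂ) * z := by
      funext z; simp [rotateAbout]
    rw [hrot, ← hi]
    have h0 := path_rotate hb5 h1 h2
    clear hi
    induction i with
    | zero => simp
    | succ i ih =>
      have : (fun z => b ^ (i + 1) * z) = (fun z => b ^ i * z) ∘ fun z => b * z := by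
        funext z; simp only [Function.comp]; ring
      rw [this, Set.image_comp, h0, ih]

theorem not_hasRotationalSymmetry {w : List (Fin 4)} (h : τ.HasTreeWord w)
    (hF : (treeResidue w).1 = (treeResidue w).2) : ¬ HasRotationalSymmetry τ.path := by
  rintro ⟨c, a, ha, himg⟩
  obtain ⟨h5, hret⟩ := rotation_of_image_eq himg
  have ha1 : (a : ℂ) ≠ 1 := fun h => ha (Circle.ext (by simpa using h))
  have hsq : (a : ℂ) ^ 2 ≠ 1 := by
    intro h
    apply ha1
    linear_combination h5 - (a : ℂ) * ((a : ℂ) ^ 2 + 1) * h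
  obtain ⟨n, k, r, hr, hdir⟩ := h.dir_eq
  obtain ⟨m, ⟨hp, hd⟩ | ⟨hp, hd⟩⟩ := hret ha n
  -- Squaring the rotation doubles the number of bounces. The unfolding then ends in the original
  -- copy, where the displacement determines the rotation.
  · have hp2 := determined h5 hp hd (m - n)
    have hd2 := dir_determined h5 hp hd (m - n)
    rw [add_sub_cancel, hp] at hp2
    rw [add_sub_cancel, hd] at hd2
    rw [← mul_assoc, ← pow_two] at hp2 hd2
    have heven : Even (m + (m - n) - n) := ⟨m - n, by ring⟩
    obtain ⟨l, t, z, hl, hz, e⟩ := return_displacement heven hp2 hd2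
    have hs : 2 * sn * φ ≠ 0 := by
      have := sn_ne; have := gold_pos.ne'
      positivity
    have hs' : (2 * sn * φ : ℂ) ≠ 0 := by exact_mod_cast hs
    have hz' := hz.omega_pow_mul (9 * k)
    -- The power ω^(9k) inverts ω^k, so it turns the holonomy back to the direction of the tree
    -- vector.
    have h10 : omega ^ (9 * k) * omega ^ k = 1 := by
      rw [← pow_add, show 9 * k + k = 5 * (2 * k) by ring, pow_mul, omega_pow_five, pow_mul]
      norm_num
    have hpar : omega ^ (9 * k) * z = (t * r / (2 * sn * φ) : ℝ) * pentagonVector w := by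
      rw [hdir] at e
      apply mul_left_cancel₀ hs'
      push_cast
      rw [← mul_assoc (2 * (sn : ℂ) * φ) ((t : ℂ) * r / _), mul_div_cancel₀ _ hs']
      linear_combination (-omega ^ (9 * k)) * e + (t * r * pentagonVector w) * h10
    have h0 := hz'.eq_zero_of_parallel hpar hF
    have d1 : (-1 : ZMod 5) ≠ 0 := by decide
    have d3 : (3 : ZMod 5) ≠ 0 := by decide
    have hprime : Fact (Nat.Prime 5) := ⟨by norm_num⟩
    have hl0 : (l : ZMod 5) = 0 := by
      rcases mul_eq_zero.1 h0 with h | h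
      · exact absurd h (pow_ne_zero _ d1)
      · exact (mul_eq_zero.1 h).resolve_left d3
    rw [(zeta_zpow_eq_one_iff l).2 hl0, one_mul] at hl
    exact hsq hl
  · have hp' : τ.rev.pt (-(m + 1)) = a * τ.pt n := by
      rw [← hp]; simp only [rev, neg_neg]
    have hd' : τ.rev.dir (-(m + 1)) = a * τ.dir n := by
      rw [← hd, rev_dir, neg_neg, add_sub_cancel_right]
    -- The rotation matches τ with its reversal, so it exchanges bounce n and bounce m + 1, and its
    -- square fixes the point of bounce n.
    have h1 := determined h5 hp' hd' (m + 1 - n)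
    rw [show -(m + 1) + (m + 1 - n) = -n by ring, show n + (m + 1 - n) = m + 1 by ring, hp] at h1
    simp only [rev, neg_neg] at h1
    have hne : τ.pt n ≠ 0 := by
      intro h
      have := τ.dot_pt n
      rw [h] at this
      simp [dot] at this
      linarith [gold_pos]
    apply hsq
    apply mul_right_cancel₀ hne
    linear_combination -h1

end Trajectory

end

end PentagonBilliard

theorem mainTheorem4 (τ : PentagonBilliard.Trajectory) (w : List (Fin 4))
    (hw : τ.HasTreeWord w) :
    (PentagonBilliard.endNode w ∈
        ({.A, .B, .C, .D, .E} : Set PentagonBilliard.Node) →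
      PentagonBilliard.HasRotationalSymmetryOfOrder 5 0 τ.path) ∧
    (PentagonBilliard.endNode w = PentagonBilliard.Node.F →
      ¬ PentagonBilliard.HasRotationalSymmetry τ.path) := by
  refine ⟨fun h => ?_, fun h => ?_⟩
  · refine PentagonBilliard.Trajectory.hasRotationalSymmetryOfOrder_five hw ?_
    rw [Ne, ← PentagonBilliard.endNode_eq_F_iff]
    intro h'
    rw [h'] at h
    simp at h
  · exact PentagonBilliard.Trajectory.not_hasRotationalSymmetry hw
      ((PentagonBilliard.endNode_eq_F_iff w).1 h)
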